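/- Let $W$ denote the Wiener measure on $\mathcal C([0,1])$, i.e. the law of standard Brownian motion on $[0,1]$. Let $b\ge 2$ be an integer and $H\in(-\infty,1/2)$ a real number. Let $(\epsilon(w))_w$ be independent random variables on a probability space, indexed by all finite words $w$ over the alphabet $\{0,\dots,b-1\}$, each with law $p^+\delta_1+p^-\delta_{-1}$, where $p^+=\frac{1+b^{H-1}}{2}$ and $p^-=1-p^+$. For $n\ge 1$ let $B_n^H$ be the random continuous function on $[0,1]$ with $B_n^H(0)=0$ that is affine on each of the $b^n$ intervals $I_w=[t_w,t_w+b^{-n}]$, $t_w=\sum_{k=1}^n w_kb^{-k}$, where $w=w_1\cdots w_n$ runs over the words of length $n$, and whose increment over $I_w$ is $b^{-nH}\,\epsilon(w_1)\,\epsilon(w_1w_2)\cdots\epsilon(w_1\cdots w_n)$. Put $$\sigma_H=\sqrt{\frac{b-1}{b^{2-2H}-b}+1}.$$ Then, as $n\to\infty$, the law of $B_n^H/\big(\sigma_H\,b^{n(1/2-H)}\big)$ converges weakly on $\mathcal C([0,1])$ (with the uniform topology) to $W$. In particular the limit depends neither on $b$ nor on $H$. -/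

import Mathlib

open MeasureTheory ProbabilityTheory Filter Topology

/-- The space of real continuous functions on the unit interval, with the uniform topology,
carries its Borel sigma-algebra. -/
instance instMeasurableSpaceContinuousPaths : MeasurableSpace C(unitInterval, ℝ) :=
  borel C(unitInterval, ℝ)

instance instBorelSpaceContinuousPaths : BorelSpace C(unitInterval, ℝ) := ⟨rfl⟩

/-- `W` is the Wiener measure on `C([0,1])`: under `W` the coordinate process starts at `0`,
has independent increments, and its increment over `[s, t]` is Gaussian with mean `0` and
variance `t - s`. -/
structure IsWienerMeasure (W : Measure C(unitInterval, ℝ)) : Prop where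
  isProbabilityMeasure : IsProbabilityMeasure W
  start_zero : ∀ᵐ f ∂W, f 0 = 0
  hasIndepIncrements :
    HasIndepIncrements (fun (t : unitInterval) (f : C(unitInterval, ℝ)) ↦ f t) W
  hasLaw_increment : ∀ s t : unitInterval, s ≤ t →
    HasLaw (fun f : C(unitInterval, ℝ) ↦ f t - f s)
      (gaussianReal 0 (Real.toNNReal ((t : ℝ) - (s : ℝ)))) W

namespace BilateralCascade

/-- The law `p⁺ δ₁ + p⁻ δ₋₁` on the reals, where `p⁺ = (1 + b ^ (H - 1)) / 2` and
`p⁻ = 1 - p⁺`. -/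
noncomputable def signLaw (b : ℕ) (H : ℝ) : Measure ℝ :=
  ENNReal.ofReal ((1 + (b : ℝ) ^ (H - 1)) / 2) • Measure.dirac (1 : ℝ) +
    ENNReal.ofReal (1 - (1 + (b : ℝ) ^ (H - 1)) / 2) • Measure.dirac (-1 : ℝ)

/-- The left end point `t_w = w₁ b⁻¹ + ⋯ + w_n b⁻ⁿ` of the `b`-adic interval
`I_w = [t_w, t_w + b⁻ⁿ]` coded by the word `w` of length `n`. -/
noncomputable def leftEnd (b n : ℕ) (w : Fin n → Fin b) : ℝ :=
  ∑ k : Fin n, ((w k : ℕ) : ℝ) / (b : ℝ) ^ ((k : ℕ) + 1)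

/-- The proportion of the interval `I_w` that lies to the left of `t`. As a function of `t`
it is `0` to the left of `I_w`, `1` to the right of it, and affine on `I_w`. -/
noncomputable def ramp (b n : ℕ) (w : Fin n → Fin b) : C(unitInterval, ℝ) where
  toFun t := max 0 (min 1 ((b : ℝ) ^ n * ((t : ℝ) - leftEnd b n w)))
  continuous_toFun := by fun_prop

/-- The product `ε(w|1) ⋯ ε(w|n)` of the signs of the nonempty prefixes of the word `w` of
length `n`, for a family `ε` of signs indexed by all finite words in `{0, …, b - 1}`. -/
def signProd {b : ℕ} (ε : List (Fin b) → ℝ) (n : ℕ) (w : Fin n → Fin b) : ℝ :=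
  ∏ k ∈ Finset.Icc 1 n, ε ((List.ofFn w).take k)

/-- The function `B_n^H` built from the signs `ε`: it vanishes at `0`, is affine on each of the
`bⁿ` intervals `I_w` with `w` of length `n`, and its increment over `I_w` is
`b ^ (-n H) ε(w|1) ⋯ ε(w|n)`. -/
noncomputable def cascade (b : ℕ) (H : ℝ) (ε : List (Fin b) → ℝ) (n : ℕ) :
    C(unitInterval, ℝ) :=
  ∑ w : Fin n → Fin b, ((b : ℝ) ^ (-((n : ℝ) * H)) * signProd ε n w) • ramp b n w

/-- The constant `σ_H`, for `H < 1/2`. -/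
noncomputable def sigma (b : ℕ) (H : ℝ) : ℝ :=
  Real.sqrt (((b : ℝ) - 1) / ((b : ℝ) ^ (2 - 2 * H) - (b : ℝ)) + 1)

end BilateralCascade

/-!
# Convergence of the bilateral cascade to Brownian motion

The whole family of signs is an element `ε` of `List (Fin b) → ℝ` with law `signMeasure b H`, an
infinite product. Write `path b H n ε` for the normalised cascade of generation `n`, and
`shift j ε` for the signs in the subtree of the words that begin with the letter `j`. These
subfamilies are independent copies of `ε` (`iIndepFun_shift`, `measurePreserving_shift`), and
everything rests on the self-similarity relation (`path_succ`)
`path (n + 1) ε t = b ^ (-1/2) * ∑ j, ε [j] * path n (shift j ε) (zoom j t)`,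
where `zoom j t` is `b t - j` clamped to `[0, 1]`.

*End point.* By `path_succ` the end point `path n ε 1` has a mean that decays geometrically and a
second moment that tends to `1`, thanks to the choice of `σ_H`; Hoeffding's inequality propagates a
sub-Gaussian bound through the recursion, so that all moments are bounded in `n`
(`exists_integral_abs_pow_le`). One step of the recursion for the characteristic function
fixes the standard Gaussian one and multiplies the distance to it by at most `b`, while it divides
the argument by `√b`. Iterating `k` times contracts the third-order error of the Taylor expansion
by `b ^ (-k/2)`; letting first `n` and then `k` tend to infinity gives the central limit theorem
`tendsto_endChar`.

*Finite-dimensional laws.* The joint characteristic functions of Brownian motion satisfy the same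
recursion (`prod_brownianChar_zoom`, because `∑ j, zoom j t = b t`), so that induction on the level
`m` reduces the convergence at times in `b ^ (-m) ℤ` to that of the end point
(`tendsto_pathChar`).

*Tightness.* By `path_succ` again, an increment over a `b`-adic interval of length `b ^ (-m)` has a
fourth moment of order `b ^ (-2 m)`, uniformly in `n`. Chaining and the Arzelà–Ascoli theorem turn
this into tightness (`isTightMeasureSet_pathLaw`).

*Conclusion.* By Prokhorov's theorem the laws have cluster points; each of them has the
characteristic functions of Brownian motion, at `b`-adic times and then at all times by continuity
of the paths. These characteristic functions determine the measure (`HasBrownianChar.unique`) and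
characterise Wiener measure (`HasBrownianChar.isWienerMeasure`). Hence there is only one cluster
point, the same for all `b` and `H`. The existence of Wiener measure comes from the same argument,
as a cluster point for one choice of `b` and `H`.
-/

namespace BilateralCascade

/-! ### The product measure on families of signs -/

/-- The law of the sign family `ε`: the product of copies of `signLaw b H` over all finite words. -/
noncomputable def signMeasure (b : ℕ) (H : ℝ) : Measure (List (Fin b) → ℝ) :=
  Measure.infinitePi fun _ ↦ signLaw b H

/-- The sign family seen from the subtree of words that begin with the letter `j`. -/
def shift {b : ℕ} (j : Fin b) (ε : List (Fin b) → ℝ) : List (Fin b) → ℝ := fun l ↦ ε (j :: l)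

@[fun_prop]
lemma continuous_shift {b : ℕ} (j : Fin b) : Continuous (shift j) := by
  unfold shift; fun_prop

lemma rpow_bias_lt_one {b : ℕ} (hb : 2 ≤ b) {H : ℝ} (hH : H < 1 / 2) : (b : ℝ) ^ (H - 1) < 1 :=
  Real.rpow_lt_one_of_one_lt_of_neg (by exact_mod_cast hb) (by linarith)

lemma integral_signLaw {b : ℕ} (hb : 2 ≤ b) {H : ℝ} (hH : H < 1 / 2) {F : Type*}
    [NormedAddCommGroup F] [NormedSpace ℝ F] [CompleteSpace F] (f : ℝ → F) :
    ∫ x, f x ∂signLaw b H =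
      ((1 + (b : ℝ) ^ (H - 1)) / 2) • f 1 + ((1 - (b : ℝ) ^ (H - 1)) / 2) • f (-1) := by
  have h1 := rpow_bias_lt_one hb hH
  have h0 : 0 < (b : ℝ) ^ (H - 1) := by positivity
  unfold signLaw
  rw [integral_add_measure, integral_smul_measure, integral_smul_measure, integral_dirac,
    integral_dirac, ENNReal.toReal_ofReal (by linarith), ENNReal.toReal_ofReal (by linarith)]
  · congr 2
    ring
  · exact (integrable_dirac (by simp)).smul_measure (by simp)
  · exact (integrable_dirac (by simp)).smul_measure (by simp)

lemma isProbabilityMeasure_signLaw {b : ℕ} (hb : 2 ≤ b) {H : ℝ} (hH : H < 1 / 2) :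
    IsProbabilityMeasure (signLaw b H) := by
  have h1 := rpow_bias_lt_one hb hH
  have h0 : 0 < (b : ℝ) ^ (H - 1) := by positivity
  constructor
  simp only [signLaw, Measure.add_apply, Measure.smul_apply, measure_univ, smul_eq_mul, mul_one]
  rw [← ENNReal.ofReal_add (by linarith) (by linarith)]
  simp

lemma isProbabilityMeasure_signMeasure {b : ℕ} (hb : 2 ≤ b) {H : ℝ} (hH : H < 1 / 2) :
    IsProbabilityMeasure (signMeasure b H) := by
  have := isProbabilityMeasure_signLaw hb hH
  unfold signMeasure; infer_instance

/-- Almost every sign family takes only the values `1` and `-1`. -/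
lemma ae_eq_one_or {b : ℕ} (hb : 2 ≤ b) {H : ℝ} (hH : H < 1 / 2) :
    ∀ᵐ ε ∂signMeasure b H, ∀ w, ε w = 1 ∨ ε w = -1 := by
  have := isProbabilityMeasure_signLaw hb hH
  rw [ae_all_iff]
  intro w
  have h : ∀ᵐ x ∂signLaw b H, x = 1 ∨ x = -1 := by
    rw [ae_iff]
    simp [signLaw]
  have hm := measurePreserving_eval_infinitePi (fun _ : List (Fin b) ↦ signLaw b H) w
  exact hm.quasiMeasurePreserving.ae h

/-- Since `signMeasure b H` is carried by the compact set `{1, -1} ^ List (Fin b)`, every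
continuous function is integrable. -/
lemma integrable_of_continuous {b : ℕ} (hb : 2 ≤ b) {H : ℝ} (hH : H < 1 / 2) {F : Type*}
    [NormedAddCommGroup F] {f : (List (Fin b) → ℝ) → F}
    (hf : Continuous f) : Integrable f (signMeasure b H) := by
  have := isProbabilityMeasure_signMeasure hb hH
  have hK : IsCompact (Set.univ.pi fun _ : List (Fin b) ↦ ({1, -1} : Set ℝ)) :=
    isCompact_univ_pi fun _ ↦ (Set.toFinite _).isCompact
  obtain ⟨C, hC⟩ := hK.exists_bound_of_continuousOn hf.continuousOn
  refine Integrable.of_bound hf.aestronglyMeasurable C ?_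
  filter_upwards [ae_eq_one_or hb hH] with ε hε using hC ε fun w _ ↦ hε w

lemma map_shift_signMeasure {b : ℕ} (hb : 2 ≤ b) {H : ℝ} (hH : H < 1 / 2) :
    (signMeasure b H).map (fun ε (j : Fin b) ↦ shift j ε) =
      Measure.pi fun _ ↦ signMeasure b H := by
  have := isProbabilityMeasure_signLaw hb hH
  have := isProbabilityMeasure_signMeasure hb hH
  have hinj : Function.Injective (fun p : Fin b × List (Fin b) ↦ p.1 :: p.2) := by
    rintro ⟨i, l⟩ ⟨j, l'⟩ h
    simpa using h
  have h1 := Measure.map_infinitePi_infinitePi_of_inj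
    (P := fun _ : List (Fin b) ↦ signLaw b H) hinj
  have h2 := Measure.infinitePi_map_curry
    (fun (_ : Fin b) (_ : List (Fin b)) ↦ signLaw b H)
  rw [← h1, Measure.map_map (by fun_prop) (by fun_prop),
    Measure.infinitePi_eq_pi (ι := Fin b)] at h2
  exact h2

/-- The sign families seen from the `b` subtrees of the root are independent. -/
lemma iIndepFun_shift {b : ℕ} (hb : 2 ≤ b) {H : ℝ} (hH : H < 1 / 2) :
    iIndepFun (fun (j : Fin b) ε ↦ shift j ε) (signMeasure b H) := by
  have := isProbabilityMeasure_signMeasure hb hH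
  rw [iIndepFun_iff_map_fun_eq_pi_map (fun j ↦ (continuous_shift j).aemeasurable),
    map_shift_signMeasure hb hH]
  congr with j : 1
  have h := congrArg (Measure.map (Function.eval j)) (map_shift_signMeasure hb hH)
  rw [(measurePreserving_eval _ j).map_eq, Measure.map_map (by fun_prop)
    (measurable_pi_lambda _ fun j ↦ (continuous_shift j).measurable)] at h
  exact h.symm

/-- The sign family seen from a child of the root has the same law as the whole family. -/
lemma measurePreserving_shift {b : ℕ} (hb : 2 ≤ b) {H : ℝ} (hH : H < 1 / 2) (j : Fin b) :
    MeasurePreserving (shift j) (signMeasure b H) (signMeasure b H) := by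
  have := isProbabilityMeasure_signMeasure hb hH
  refine ⟨(continuous_shift j).measurable, ?_⟩
  have h := congrArg (Measure.map (Function.eval j)) (map_shift_signMeasure hb hH)
  rw [(measurePreserving_eval _ j).map_eq, Measure.map_map (by fun_prop)
    (measurable_pi_lambda _ fun j ↦ (continuous_shift j).measurable)] at h
  exact h

lemma integral_comp_shift {b : ℕ} (hb : 2 ≤ b) {H : ℝ} (hH : H < 1 / 2) (j : Fin b) {F : Type*}
    [NormedAddCommGroup F] [NormedSpace ℝ F] {f : (List (Fin b) → ℝ) → F} (hf : Continuous f) :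
    ∫ ε, f (shift j ε) ∂signMeasure b H = ∫ ε, f ε ∂signMeasure b H := by
  have h := measurePreserving_shift hb hH j
  conv_rhs => rw [← h.map_eq]
  rw [integral_map h.measurable.aemeasurable]
  rw [h.map_eq]
  exact (integrable_of_continuous hb hH hf).aestronglyMeasurable

/-- Averaging first over the sign at the root. The sign `ε []` is independent of any function of
the other signs. -/
lemma integral_root {b : ℕ} (hb : 2 ≤ b) {H : ℝ} (hH : H < 1 / 2) {F : Type*}
    [NormedAddCommGroup F] [NormedSpace ℝ F] [CompleteSpace F]
    {f : ℝ → (List (Fin b) → ℝ) → F} (hf : Continuous fun p : ℝ × (List (Fin b) → ℝ) ↦ f p.1 p.2)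
    (hroot : ∀ x ε y, f x (Function.update ε [] y) = f x ε) :
    ∫ ε, f (ε []) ε ∂signMeasure b H =
      ((1 + (b : ℝ) ^ (H - 1)) / 2) • ∫ ε, f 1 ε ∂signMeasure b H +
        ((1 - (b : ℝ) ^ (H - 1)) / 2) • ∫ ε, f (-1) ε ∂signMeasure b H := by
  have := isProbabilityMeasure_signLaw hb hH
  have := isProbabilityMeasure_signMeasure hb hH
  have hm : Continuous
      (fun p : ℝ × (List (Fin b) → ℝ) ↦ Function.update p.2 ([] : List (Fin b)) p.1) :=
    continuous_snd.update _ continuous_fst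
  have hmap : ((signLaw b H).prod (signMeasure b H)).map
      (fun p : ℝ × (List (Fin b) → ℝ) ↦ Function.update p.2 ([] : List (Fin b)) p.1) =
        signMeasure b H := by
    refine Measure.eq_infinitePi _ fun s t ht ↦ ?_
    rw [Measure.map_apply hm.measurable
      (MeasurableSet.pi s.countable_toSet fun i _ ↦ ht i)]
    by_cases hs : ([] : List (Fin b)) ∈ s
    · have h1 : (fun p : ℝ × (List (Fin b) → ℝ) ↦ Function.update p.2 ([] : List (Fin b)) p.1) ⁻¹'
          (Set.pi s t) = (t []) ×ˢ (Set.pi (s.erase []) t) := by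
        ext ⟨x, ε⟩
        simp only [Set.mem_preimage, Set.mem_pi, Finset.mem_coe, Set.mem_prod, Finset.mem_erase]
        constructor
        · intro h
          refine ⟨by simpa using h [] hs, fun w hw ↦ ?_⟩
          simpa [Function.update_of_ne hw.1] using h w hw.2
        · rintro ⟨h1, h2⟩ w hw
          by_cases hw0 : w = []
          · subst hw0; simpa using h1
          · rw [Function.update_of_ne hw0]
            exact h2 w ⟨hw0, hw⟩
      rw [h1, Measure.prod_prod, signMeasure, Measure.infinitePi_pi _ (fun i _ ↦ ht i),
        Finset.mul_prod_erase s (fun i ↦ signLaw b H (t i)) hs]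
    · have h1 : (fun p : ℝ × (List (Fin b) → ℝ) ↦ Function.update p.2 ([] : List (Fin b)) p.1) ⁻¹'
          (Set.pi s t) = Set.univ ×ˢ (Set.pi s t) := by
        ext ⟨x, ε⟩
        simp only [Set.mem_preimage, Set.mem_pi, Finset.mem_coe, Set.mem_prod, Set.mem_univ,
          true_and]
        refine forall₂_congr fun w hw ↦ ?_
        rw [Function.update_of_ne (ne_of_mem_of_not_mem hw hs)]
      rw [h1, Measure.prod_prod, signMeasure, Measure.infinitePi_pi _ (fun i _ ↦ ht i)]
      simp
  have hg : Continuous fun ε : List (Fin b) → ℝ ↦ f (ε []) ε :=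
    hf.comp (f := fun ε : List (Fin b) → ℝ ↦ (ε [], ε))
      ((continuous_apply _).prodMk continuous_id)
  have hint := integrable_of_continuous hb hH hg
  rw [← hmap] at hint
  have hint' := hint.comp_aemeasurable hm.aemeasurable
  conv_lhs => rw [← hmap]
  rw [integral_map hm.aemeasurable hint.aestronglyMeasurable]
  have h2 := integral_prod _ hint'
  simp only [Function.comp_def, Function.update_self, hroot] at h2
  simp only [Function.update_self, hroot]
  rw [h2, integral_signLaw hb hH]

/-! ### The recursive structure of the cascade -/

/-- The affine zoom that maps the `j`-th of the `b` subintervals of `[0, 1]` onto `[0, 1]`,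
extended by `0` to its left and by `1` to its right. -/
noncomputable def zoom (b j : ℕ) (t : unitInterval) : unitInterval :=
  Set.projIcc 0 1 zero_le_one ((b : ℝ) * t - j)

lemma coe_zoom (b j : ℕ) (t : unitInterval) :
    (zoom b j t : ℝ) = max 0 (min 1 ((b : ℝ) * t - j)) := by
  simp [zoom, Set.coe_projIcc]

lemma leftEnd_cons {b n : ℕ} (hb : 2 ≤ b) (j : Fin b) (w : Fin n → Fin b) :
    leftEnd b (n + 1) (Fin.cons j w) = ((j : ℕ) + leftEnd b n w) / b := by
  have : (b : ℝ) ≠ 0 := by positivity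
  simp only [leftEnd, Fin.sum_univ_succ, Fin.cons_zero, Fin.cons_succ, Fin.val_zero, Fin.val_succ,
    add_div, Finset.sum_div]
  congr 1
  · simp
  · refine Finset.sum_congr rfl fun k _ ↦ ?_
    field_simp
    ring

lemma leftEnd_mem {b : ℕ} (hb : 2 ≤ b) (n : ℕ) (w : Fin n → Fin b) :
    0 ≤ leftEnd b n w ∧ (b : ℝ) ^ n * leftEnd b n w + 1 ≤ (b : ℝ) ^ n := by
  have hb0 : (0 : ℝ) < b := by positivity
  induction n with
  | zero => simp [leftEnd]
  | succ n ih =>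
    obtain ⟨h1, h2⟩ := ih (Fin.tail w)
    have hw : w = Fin.cons (w 0) (Fin.tail w) := (Fin.cons_self_tail w).symm
    have hj : ((w 0 : ℕ) : ℝ) + 1 ≤ b := by exact_mod_cast (w 0).isLt
    rw [hw, leftEnd_cons hb]
    refine ⟨by positivity, ?_⟩
    have h3 : (b : ℝ) ^ (n + 1) * ((((w 0 : ℕ) : ℝ) + leftEnd b n (Fin.tail w)) / b) =
        (b : ℝ) ^ n * (w 0 : ℕ) + (b : ℝ) ^ n * leftEnd b n (Fin.tail w) := by
      field_simp
      ring
    rw [h3, pow_succ]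
    nlinarith [pow_pos hb0 n]

lemma ramp_cons {b n : ℕ} (hb : 2 ≤ b) (j : Fin b) (w : Fin n → Fin b) (t : unitInterval) :
    ramp b (n + 1) (Fin.cons j w) t = ramp b n w (zoom b j t) := by
  have hb0 : (0 : ℝ) < b := by positivity
  obtain ⟨h1, h2⟩ := leftEnd_mem hb n w
  have hp := pow_pos hb0 n
  simp only [ramp, ContinuousMap.coe_mk, leftEnd_cons hb, coe_zoom]
  have h3 : (b : ℝ) ^ (n + 1) * (t - ((j : ℕ) + leftEnd b n w) / b) =
      (b : ℝ) ^ n * ((b * t - (j : ℕ)) - leftEnd b n w) := by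
    field_simp
    ring
  rw [h3]
  set x : ℝ := b * t - (j : ℕ)
  rcases le_total x 0 with hx | hx
  · have e1 : max 0 (min 1 x) = 0 := by
      rw [max_eq_left]; exact (min_le_right _ _).trans hx
    rw [e1, max_eq_left, max_eq_left]
    · exact (min_le_right _ _).trans (by nlinarith)
    · exact (min_le_right _ _).trans (by nlinarith)
  rcases le_total x 1 with hx1 | hx1
  · rw [min_eq_right hx1, max_eq_right hx]
  · rw [min_eq_left hx1, max_eq_right zero_le_one, min_eq_left, min_eq_left]
    · nlinarith
    · nlinarith

lemma signProd_cons {b n : ℕ} (ε : List (Fin b) → ℝ) (j : Fin b) (w : Fin n → Fin b) :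
    signProd ε (n + 1) (Fin.cons j w) = ε [j] * signProd (shift j ε) n w := by
  have h : ∀ m (g : ℕ → ℝ), ∏ k ∈ Finset.Icc 1 m, g k = ∏ k ∈ Finset.range m, g (k + 1) := by
    intro m g
    rw [Finset.range_eq_Ico, Finset.prod_Ico_add' g 0 m 1]
    rfl
  simp only [signProd, h]
  rw [Finset.prod_range_succ']
  simp [List.ofFn_succ, shift, mul_comm]

lemma cascade_succ {b : ℕ} (hb : 2 ≤ b) (H : ℝ) (ε : List (Fin b) → ℝ) (n : ℕ)
    (t : unitInterval) :
    cascade b H ε (n + 1) t =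
      (b : ℝ) ^ (-H) * ∑ j : Fin b, ε [j] * cascade b H (shift j ε) n (zoom b j t) := by
  have hb0 : (0 : ℝ) < b := by positivity
  simp only [cascade, ContinuousMap.sum_apply, ContinuousMap.smul_apply, smul_eq_mul]
  rw [← (Fin.consEquiv fun _ : Fin (n + 1) ↦ Fin b).sum_comp, Fintype.sum_prod_type,
    Finset.mul_sum]
  refine Finset.sum_congr rfl fun j _ ↦ ?_
  rw [Finset.mul_sum, Finset.mul_sum]
  refine Finset.sum_congr rfl fun w _ ↦ ?_
  simp only [Fin.consEquiv, Equiv.coe_fn_mk]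
  rw [ramp_cons hb, signProd_cons]
  have : (b : ℝ) ^ (-(((n + 1 : ℕ) : ℝ) * H)) = (b : ℝ) ^ (-H) * (b : ℝ) ^ (-((n : ℝ) * H)) := by
    rw [← Real.rpow_add hb0]
    push_cast
    ring_nf
  rw [this]
  ring

lemma cascade_zero (b : ℕ) (H : ℝ) (ε : List (Fin b) → ℝ) (t : unitInterval) :
    cascade b H ε 0 t = t := by
  have h0 := t.2.1
  have h1 := t.2.2
  simp [cascade, signProd, ramp, leftEnd, h0, h1]

lemma cascade_update_root {b : ℕ} (H : ℝ) (ε : List (Fin b) → ℝ) (x : ℝ) (n : ℕ) :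
    cascade b H (Function.update ε [] x) n = cascade b H ε n := by
  unfold cascade
  refine Finset.sum_congr rfl fun w _ ↦ ?_
  congr 2
  refine Finset.prod_congr rfl fun k hk ↦ Function.update_of_ne ?_ _ _
  rw [Finset.mem_Icc] at hk
  intro h
  rw [List.take_eq_nil_iff] at h
  rcases h with h | h
  · omega
  · rw [List.ofFn_eq_nil_iff] at h
    omega

/-- The normalised cascade, whose limit in law is Brownian motion. -/
noncomputable def path (b : ℕ) (H : ℝ) (n : ℕ) (ε : List (Fin b) → ℝ) : C(unitInterval, ℝ) :=
  (sigma b H * (b : ℝ) ^ ((n : ℝ) * (1 / 2 - H)))⁻¹ • cascade b H ε n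

lemma path_zero (b : ℕ) (H : ℝ) (ε : List (Fin b) → ℝ) (t : unitInterval) :
    path b H 0 ε t = (sigma b H)⁻¹ * t := by
  simp [path, cascade_zero]

/-- Self-similarity: the normalised cascade is a concatenation of `b` signed rescaled copies of
the cascade of the previous generation. -/
lemma path_succ {b : ℕ} (hb : 2 ≤ b) (H : ℝ) (n : ℕ) (ε : List (Fin b) → ℝ) (t : unitInterval) :
    path b H (n + 1) ε t =
      ∑ j : Fin b, (√b)⁻¹ * (ε [j] * path b H n (shift j ε) (zoom b j t)) := by
  have hb0 : (0 : ℝ) < b := by positivity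
  simp only [path, ContinuousMap.smul_apply, smul_eq_mul, cascade_succ hb, Finset.mul_sum]
  refine Finset.sum_congr rfl fun j _ ↦ ?_
  have h : (b : ℝ) ^ (((n + 1 : ℕ) : ℝ) * (1 / 2 - H)) =
      (b : ℝ) ^ ((n : ℝ) * (1 / 2 - H)) * (√b * (b : ℝ) ^ (-H)) := by
    rw [Real.sqrt_eq_rpow, ← Real.rpow_add hb0, ← Real.rpow_add hb0]
    push_cast
    ring_nf
  have h2 : (b : ℝ) ^ (-H) ≠ 0 := by positivity
  rw [h, mul_inv, mul_inv, mul_inv, mul_inv]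
  field_simp

lemma path_update_root {b : ℕ} (H : ℝ) (n : ℕ) (ε : List (Fin b) → ℝ) (x : ℝ) :
    path b H n (Function.update ε [] x) = path b H n ε := by
  simp [path, cascade_update_root]

@[fun_prop]
lemma continuous_path (b : ℕ) (H : ℝ) (n : ℕ) : Continuous (path b H n) := by
  unfold path cascade signProd
  fun_prop

lemma continuous_path_apply (b : ℕ) (H : ℝ) (n : ℕ) (t : unitInterval) :
    Continuous fun ε ↦ path b H n ε t :=
  (continuous_eval_const t).comp (continuous_path b H n)

lemma path_apply_zero {b : ℕ} (hb : 2 ≤ b) (H : ℝ) (n : ℕ) (ε : List (Fin b) → ℝ) :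
    path b H n ε 0 = 0 := by
  induction n generalizing ε with
  | zero => simp [path_zero]
  | succ n ih =>
    have h : ∀ j : ℕ, zoom b j 0 = 0 := fun j ↦ by
      apply Subtype.ext
      rw [coe_zoom]
      simp
    rw [path_succ hb]
    simp [h, ih]

lemma zoom_one {b j : ℕ} (hj : j < b) : zoom b j 1 = 1 := by
  apply Subtype.ext
  have : (j : ℝ) + 1 ≤ b := by exact_mod_cast hj
  rw [coe_zoom]
  simp only [Set.Icc.coe_one, mul_one]
  rw [min_eq_left (by linarith)]
  simp

/-! ### Moments of the end point -/

lemma sigma_sq {b : ℕ} (hb : 2 ≤ b) {H : ℝ} (hH : H < 1 / 2) :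
    1 ≤ sigma b H ∧ sigma b H ^ 2 = 1 + ((b : ℝ) - 1) * ((b : ℝ) ^ (H - 1)) ^ 2 /
      (1 - (√b * (b : ℝ) ^ (H - 1)) ^ 2) := by
  have hb1 : (1 : ℝ) < b := by exact_mod_cast hb
  have hb0 : (0 : ℝ) < b := by positivity
  have h1 : (b : ℝ) < (b : ℝ) ^ (2 - 2 * H) := by
    conv_lhs => rw [← Real.rpow_one (b : ℝ)]
    exact Real.rpow_lt_rpow_of_exponent_lt hb1 (by linarith)
  have h2 : (0 : ℝ) ≤ ((b : ℝ) - 1) / ((b : ℝ) ^ (2 - 2 * H) - (b : ℝ)) :=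
    div_nonneg (by linarith) (by linarith)
  refine ⟨Real.one_le_sqrt.2 (by linarith), ?_⟩
  rw [sigma, Real.sq_sqrt (by linarith), mul_pow, Real.sq_sqrt hb0.le]
  have h3 : ((b : ℝ) ^ (H - 1)) ^ 2 = ((b : ℝ) ^ (2 - 2 * H))⁻¹ := by
    rw [← Real.rpow_natCast, ← Real.rpow_mul hb0.le, ← Real.rpow_neg hb0.le]
    push_cast
    ring_nf
  rw [h3]
  have h4 : (b : ℝ) ^ (2 - 2 * H) - b ≠ 0 := by linarith
  field_simp
  ring

/-- The ratio `√b · b ^ (H - 1) = b ^ (H - 1/2)` by which the mean of the normalised end point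
decays. -/
lemma sqrt_mul_rpow_lt_one {b : ℕ} (hb : 2 ≤ b) {H : ℝ} (hH : H < 1 / 2) :
    √b * (b : ℝ) ^ (H - 1) < 1 := by
  rw [Real.sqrt_eq_rpow, ← Real.rpow_add (by positivity)]
  exact Real.rpow_lt_one_of_one_lt_of_neg (by exact_mod_cast hb) (by linarith)

lemma path_succ_one {b : ℕ} (hb : 2 ≤ b) (H : ℝ) (n : ℕ) (ε : List (Fin b) → ℝ) :
    path b H (n + 1) ε 1 = ∑ j : Fin b, (√b)⁻¹ * (ε [j] * path b H n (shift j ε) 1) := by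
  rw [path_succ hb]
  simp only [zoom_one (Fin.isLt _)]

lemma continuous_root_mul {b : ℕ} (H : ℝ) (n : ℕ) :
    Continuous fun ε : List (Fin b) → ℝ ↦ ε [] * path b H n ε 1 :=
  (continuous_apply _).mul (continuous_path_apply b H n 1)

lemma integral_root_mul {b : ℕ} (hb : 2 ≤ b) {H : ℝ} (hH : H < 1 / 2) (n : ℕ) :
    ∫ ε, ε [] * path b H n ε 1 ∂signMeasure b H =
      (b : ℝ) ^ (H - 1) * ∫ ε, path b H n ε 1 ∂signMeasure b H := by
  have hc := continuous_path_apply b H n 1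
  rw [integral_root hb hH (f := fun x ε ↦ x * path b H n ε 1) (by fun_prop)
    (by simp [path_update_root])]
  simp only [one_mul, neg_mul, integral_neg, smul_eq_mul]
  ring

lemma integral_root_mul_sq {b : ℕ} (hb : 2 ≤ b) {H : ℝ} (hH : H < 1 / 2) (n : ℕ) :
    ∫ ε, (ε [] * path b H n ε 1) ^ 2 ∂signMeasure b H =
      ∫ ε, path b H n ε 1 ^ 2 ∂signMeasure b H := by
  have hc := continuous_path_apply b H n 1
  rw [integral_root hb hH (f := fun x ε ↦ (x * path b H n ε 1) ^ 2) (by fun_prop)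
    (by simp [path_update_root])]
  simp only [one_mul, neg_mul, even_two.neg_pow, smul_eq_mul]
  ring

lemma integral_path_one {b : ℕ} (hb : 2 ≤ b) {H : ℝ} (hH : H < 1 / 2) (n : ℕ) :
    ∫ ε, path b H n ε 1 ∂signMeasure b H =
      (sigma b H)⁻¹ * (√b * (b : ℝ) ^ (H - 1)) ^ n := by
  have := isProbabilityMeasure_signMeasure hb hH
  have hb0 : (0 : ℝ) < b := by positivity
  induction n with
  | zero => simp [path_zero]
  | succ n ih =>
    simp only [path_succ_one hb]
    have hS := continuous_root_mul (b := b) H n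
    have h1 : ∀ j : Fin b, Continuous fun ε : List (Fin b) → ℝ ↦
        (√b)⁻¹ * (ε [j] * path b H n (shift j ε) 1) := fun j ↦
      continuous_const.mul (hS.comp (continuous_shift j))
    rw [integral_finsetSum _ fun j _ ↦ integrable_of_continuous hb hH (h1 j)]
    have h2 : ∀ j : Fin b, ∫ ε, (√b)⁻¹ * (ε [j] * path b H n (shift j ε) 1) ∂signMeasure b H =
        (√b)⁻¹ * ((b : ℝ) ^ (H - 1) * ((sigma b H)⁻¹ * (√b * (b : ℝ) ^ (H - 1)) ^ n)) := by
      intro j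
      rw [integral_const_mul, ← ih, ← integral_root_mul hb hH]
      congr 1
      exact integral_comp_shift hb hH j hS
    simp only [h2, Finset.sum_const, Finset.card_univ, Fintype.card_fin, nsmul_eq_mul]
    have h3 : (b : ℝ) * (√b)⁻¹ = √b := by
      rw [← div_eq_mul_inv, Real.div_sqrt]
    rw [pow_succ]
    linear_combination ((b : ℝ) ^ (H - 1) * ((sigma b H)⁻¹ * (√b * (b : ℝ) ^ (H - 1)) ^ n)) * h3

/-- The variances of the independent summands add up, so the second moment grows only through
the mean. -/
lemma integral_path_one_sq_succ {b : ℕ} (hb : 2 ≤ b) {H : ℝ} (hH : H < 1 / 2) (n : ℕ) :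
    ∫ ε, path b H (n + 1) ε 1 ^ 2 ∂signMeasure b H =
      ∫ ε, path b H n ε 1 ^ 2 ∂signMeasure b H +
        ((b : ℝ) - 1) * ((b : ℝ) ^ (H - 1)) ^ 2 * (∫ ε, path b H n ε 1 ∂signMeasure b H) ^ 2 := by
  have := isProbabilityMeasure_signMeasure hb hH
  have hb0 : (0 : ℝ) < b := by positivity
  have hS := continuous_root_mul (b := b) H n
  have hL : ∀ {f : (List (Fin b) → ℝ) → ℝ}, Continuous f → MemLp f 2 (signMeasure b H) := by
    intro f hf
    rw [memLp_two_iff_integrable_sq hf.aestronglyMeasurable]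
    exact integrable_of_continuous hb hH (hf.pow 2)
  have hX : ∀ j : Fin b, Continuous fun ε : List (Fin b) → ℝ ↦
      (√b)⁻¹ * (ε [j] * path b H n (shift j ε) 1) := fun j ↦
    continuous_const.mul (hS.comp (continuous_shift j))
  have hv : Var[fun ε ↦ path b H (n + 1) ε 1; signMeasure b H] =
      ∫ ε, path b H n ε 1 ^ 2 ∂signMeasure b H -
        ((b : ℝ) ^ (H - 1) * ∫ ε, path b H n ε 1 ∂signMeasure b H) ^ 2 := by
    have e : (fun ε ↦ path b H (n + 1) ε 1) = ∑ j : Fin b, fun ε : List (Fin b) → ℝ ↦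
        (√b)⁻¹ * (ε [j] * path b H n (shift j ε) 1) := by
      ext ε
      rw [path_succ_one hb, Finset.sum_apply]
    rw [e, IndepFun.variance_sum (fun j _ ↦ hL (hX j))]
    · have h1 : ∀ j : Fin b, Var[fun ε : List (Fin b) → ℝ ↦
          (√b)⁻¹ * (ε [j] * path b H n (shift j ε) 1); signMeasure b H] =
          (b : ℝ)⁻¹ * Var[fun ε : List (Fin b) → ℝ ↦ ε [] * path b H n ε 1; signMeasure b H] := by
        intro j
        rw [variance_const_mul, inv_pow, Real.sq_sqrt hb0.le]
        congr 1
        have h := measurePreserving_shift hb hH j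
        conv_rhs => rw [← h.map_eq]
        rw [variance_map hS.aemeasurable h.measurable.aemeasurable]
        rfl
      simp only [h1, Finset.sum_const, Finset.card_univ, Fintype.card_fin, nsmul_eq_mul]
      rw [mul_inv_cancel_left₀ hb0.ne', variance_eq_sub (hL hS), ← integral_root_mul hb hH,
        ← integral_root_mul_sq hb hH]
      rfl
    · intro i _ j _ hij
      have := ((iIndepFun_shift hb hH).indepFun hij).comp
        (continuous_const.mul hS : Continuous fun ε : List (Fin b) → ℝ ↦
          (√b)⁻¹ * (ε [] * path b H n ε 1)).measurable
        (continuous_const.mul hS : Continuous fun ε : List (Fin b) → ℝ ↦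
          (√b)⁻¹ * (ε [] * path b H n ε 1)).measurable
      exact this
  rw [variance_eq_sub (hL (continuous_path_apply b H (n + 1) 1))] at hv
  simp only [Pi.pow_apply, integral_path_one hb hH] at hv ⊢
  have hs : √(b : ℝ) ^ 2 = b := Real.sq_sqrt hb0.le
  rw [pow_succ (√b * (b : ℝ) ^ (H - 1)) n] at hv
  linear_combination hv + ((b : ℝ) ^ (H - 1)) ^ 2 *
    ((sigma b H)⁻¹ * (√b * (b : ℝ) ^ (H - 1)) ^ n) ^ 2 * hs

lemma tendsto_integral_path_one {b : ℕ} (hb : 2 ≤ b) {H : ℝ} (hH : H < 1 / 2) :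
    Tendsto (fun n ↦ ∫ ε, path b H n ε 1 ∂signMeasure b H) atTop (𝓝 0) := by
  simp only [integral_path_one hb hH]
  have h := tendsto_pow_atTop_nhds_zero_of_lt_one (by positivity) (sqrt_mul_rpow_lt_one hb hH)
  simpa using h.const_mul (sigma b H)⁻¹

/-- The constant `σ_H` is what makes the limiting second moment of the end point equal to `1`. -/
lemma tendsto_integral_path_one_sq {b : ℕ} (hb : 2 ≤ b) {H : ℝ} (hH : H < 1 / 2) :
    Tendsto (fun n ↦ ∫ ε, path b H n ε 1 ^ 2 ∂signMeasure b H) atTop (𝓝 1) := by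
  have := isProbabilityMeasure_signMeasure hb hH
  obtain ⟨h1, h2⟩ := sigma_sq hb hH
  set r := √b * (b : ℝ) ^ (H - 1) with hr
  have hr0 : 0 ≤ r := by positivity
  have hr1 : r < 1 := sqrt_mul_rpow_lt_one hb hH
  have hr2 : r ^ 2 < 1 := by nlinarith
  have h3 : ∀ n, ∫ ε, path b H n ε 1 ^ 2 ∂signMeasure b H = (sigma b H)⁻¹ ^ 2 *
      (1 + ((b : ℝ) - 1) * ((b : ℝ) ^ (H - 1)) ^ 2 * ∑ i ∈ Finset.range n, (r ^ 2) ^ i) := by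
    intro n
    induction n with
    | zero => simp [path_zero]
    | succ n ih =>
      rw [integral_path_one_sq_succ hb hH, ih, integral_path_one hb hH, Finset.sum_range_succ,
        ← hr]
      ring
  simp only [h3]
  have h4 := (hasSum_geometric_of_lt_one (sq_nonneg r) hr2).tendsto_sum_nat
  have h5 := ((h4.const_mul (((b : ℝ) - 1) * ((b : ℝ) ^ (H - 1)) ^ 2)).const_add 1).const_mul
    ((sigma b H)⁻¹ ^ 2)
  convert h5 using 2
  rw [← div_eq_mul_inv, ← h2]
  field_simp

/-- A product of functions of the independent subtrees integrates to the product of integrals. -/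
lemma integral_prod_shift {b : ℕ} (hb : 2 ≤ b) {H : ℝ} (hH : H < 1 / 2) {𝕜 : Type*} [RCLike 𝕜]
    {f : Fin b → (List (Fin b) → ℝ) → 𝕜} (hf : ∀ j, Continuous (f j)) :
    ∫ ε, ∏ j, f j (shift j ε) ∂signMeasure b H = ∏ j, ∫ ε, f j ε ∂signMeasure b H := by
  rw [(iIndepFun_shift hb hH).integral_fun_prod_comp
    (fun j ↦ (continuous_shift j).aemeasurable) (fun j ↦ (hf j).aestronglyMeasurable)]
  exact Finset.prod_congr rfl fun j _ ↦ integral_comp_shift hb hH j (hf j)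

lemma integral_exp_path_one_succ {b : ℕ} (hb : 2 ≤ b) {H : ℝ} (hH : H < 1 / 2) (n : ℕ) (x : ℝ) :
    ∫ ε, Real.exp (x * path b H (n + 1) ε 1) ∂signMeasure b H =
      ((1 + (b : ℝ) ^ (H - 1)) / 2 *
          ∫ ε, Real.exp (((√b)⁻¹ * x) * path b H n ε 1) ∂signMeasure b H +
        (1 - (b : ℝ) ^ (H - 1)) / 2 *
          ∫ ε, Real.exp (-((√b)⁻¹ * x) * path b H n ε 1) ∂signMeasure b H) ^ b := by
  have hc := continuous_path_apply b H n 1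
  have h1 : ∀ ε : List (Fin b) → ℝ, Real.exp (x * path b H (n + 1) ε 1) =
      ∏ j : Fin b, (fun ε ↦ Real.exp ((ε [] * ((√b)⁻¹ * x)) * path b H n ε 1)) (shift j ε) := by
    intro ε
    rw [← Real.exp_sum, path_succ_one hb, Finset.mul_sum]
    congr 1
    refine Finset.sum_congr rfl fun j _ ↦ ?_
    simp only [shift]
    ring
  simp only [h1]
  rw [integral_prod_shift hb hH (f := fun _ ε ↦ Real.exp ((ε [] * ((√b)⁻¹ * x)) * path b H n ε 1))
    (fun _ ↦ by fun_prop)]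
  rw [integral_root hb hH (f := fun y ε ↦ Real.exp ((y * ((√b)⁻¹ * x)) * path b H n ε 1))
    (by fun_prop) (by simp [path_update_root])]
  simp

/-- Hoeffding's inequality for the sign law. -/
lemma two_point_exp_le {b : ℕ} (hb : 2 ≤ b) {H : ℝ} (hH : H < 1 / 2) (x : ℝ) :
    (1 + (b : ℝ) ^ (H - 1)) / 2 * Real.exp x + (1 - (b : ℝ) ^ (H - 1)) / 2 * Real.exp (-x) ≤
      Real.exp ((b : ℝ) ^ (H - 1) * x + x ^ 2 / 2) := by
  have := isProbabilityMeasure_signLaw hb hH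
  have h := (hasSubgaussianMGF_of_mem_Icc (X := id) (a := -1) (b := 1) (μ := signLaw b H)
    aemeasurable_id (by rw [ae_iff]; simp [signLaw])).mgf_le x
  rw [mgf, integral_signLaw hb hH, integral_signLaw hb hH] at h
  simp only [id, smul_eq_mul] at h
  norm_num at h
  have e := mul_le_mul_of_nonneg_left h (Real.exp_pos ((b : ℝ) ^ (H - 1) * x)).le
  rw [mul_add, mul_left_comm _ ((1 + _) / 2), mul_left_comm _ ((1 - _) / 2), ← Real.exp_add,
    ← Real.exp_add, ← Real.exp_add] at e
  refine le_trans (le_of_eq ?_) e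
  congr 3 <;> ring

/-- The end point is sub-Gaussian, with a variance proxy that grows at each generation only by
the square of the mean. -/
lemma integral_exp_path_one_le {b : ℕ} (hb : 2 ≤ b) {H : ℝ} (hH : H < 1 / 2) (n : ℕ) (x : ℝ) :
    ∫ ε, Real.exp (x * path b H n ε 1) ∂signMeasure b H ≤
      Real.exp (x * (∫ ε, path b H n ε 1 ∂signMeasure b H) +
        (∑ i ∈ Finset.range n, (∫ ε, path b H i ε 1 ∂signMeasure b H) ^ 2) * x ^ 2 / 2) := by
  have := isProbabilityMeasure_signMeasure hb hH
  have hb0 : (0 : ℝ) < b := by positivity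
  have hκ := rpow_bias_lt_one hb hH
  have hκ0 : 0 < (b : ℝ) ^ (H - 1) := by positivity
  induction n generalizing x with
  | zero => simp [path_zero]
  | succ n ih =>
    rw [integral_exp_path_one_succ hb hH]
    have hm : ∫ ε, path b H (n + 1) ε 1 ∂signMeasure b H =
        √b * (b : ℝ) ^ (H - 1) * ∫ ε, path b H n ε 1 ∂signMeasure b H := by
      rw [integral_path_one hb hH, integral_path_one hb hH]
      ring
    rw [hm, Finset.sum_range_succ]
    set m := ∫ ε, path b H n ε 1 ∂signMeasure b H
    set S := ∑ i ∈ Finset.range n, (∫ ε, path b H i ε 1 ∂signMeasure b H) ^ 2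
    set κ := (b : ℝ) ^ (H - 1)
    set y := (√(b : ℝ))⁻¹ * x with hy
    have hs : √(b : ℝ) ^ 2 = b := Real.sq_sqrt hb0.le
    have hs0 : √(b : ℝ) ≠ 0 := by positivity
    have hy2 : b * y ^ 2 = x ^ 2 := by
      rw [hy, mul_pow, inv_pow, hs]; field_simp
    have hy1 : b * y = √b * x := by
      rw [hy]; field_simp; rw [hs]
    have hκ1 : 0 ≤ 1 - κ := by linarith
    have hle : (1 + κ) / 2 * ∫ ε, Real.exp (y * path b H n ε 1) ∂signMeasure b H +
        (1 - κ) / 2 * ∫ ε, Real.exp (-y * path b H n ε 1) ∂signMeasure b H ≤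
        Real.exp (κ * (y * m) + (y * m) ^ 2 / 2 + S * y ^ 2 / 2) := by
      calc _ ≤ (1 + κ) / 2 * Real.exp (y * m + S * y ^ 2 / 2) +
            (1 - κ) / 2 * Real.exp (-y * m + S * (-y) ^ 2 / 2) := by
            gcongr
            · exact ih y
            · exact ih (-y)
        _ = ((1 + κ) / 2 * Real.exp (y * m) + (1 - κ) / 2 * Real.exp (-(y * m))) *
            Real.exp (S * y ^ 2 / 2) := by
            rw [Real.exp_add, Real.exp_add]
            ring_nf
        _ ≤ Real.exp (κ * (y * m) + (y * m) ^ 2 / 2) * Real.exp (S * y ^ 2 / 2) := by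
            gcongr
            exact two_point_exp_le hb hH _
        _ = _ := by rw [← Real.exp_add]
    have h0 : 0 ≤ (1 + κ) / 2 * ∫ ε, Real.exp (y * path b H n ε 1) ∂signMeasure b H +
        (1 - κ) / 2 * ∫ ε, Real.exp (-y * path b H n ε 1) ∂signMeasure b H := by
      have h1 : 0 ≤ ∫ ε, Real.exp (y * path b H n ε 1) ∂signMeasure b H :=
        integral_nonneg fun _ ↦ (Real.exp_pos _).le
      have h2 : 0 ≤ ∫ ε, Real.exp (-y * path b H n ε 1) ∂signMeasure b H :=
        integral_nonneg fun _ ↦ (Real.exp_pos _).le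
      positivity
    refine (pow_le_pow_left₀ h0 hle b).trans (le_of_eq ?_)
    rw [← Real.exp_nat_mul]
    congr 1
    linear_combination κ * m * hy1 + (m ^ 2 / 2 + S / 2) * hy2

/-- The exponential moments of the end point are bounded uniformly in the generation. -/
lemma exists_integral_exp_le {b : ℕ} (hb : 2 ≤ b) {H : ℝ} (hH : H < 1 / 2) :
    ∃ C, ∀ n, ∫ ε, (Real.exp (path b H n ε 1) + Real.exp (-path b H n ε 1)) ∂signMeasure b H ≤
      C := by
  obtain ⟨hσ, -⟩ := sigma_sq hb hH
  set r := √b * (b : ℝ) ^ (H - 1) with hr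
  have hr0 : 0 ≤ r := by positivity
  have hr1 : r < 1 := sqrt_mul_rpow_lt_one hb hH
  have hr2 : r ^ 2 < 1 := by nlinarith
  have hσ1 : (sigma b H)⁻¹ ≤ 1 := inv_le_one_of_one_le₀ hσ
  have hσ0 : 0 ≤ (sigma b H)⁻¹ := by positivity
  have hm : ∀ n, |∫ ε, path b H n ε 1 ∂signMeasure b H| ≤ r ^ n := by
    intro n
    rw [integral_path_one hb hH, abs_of_nonneg (by positivity)]
    exact mul_le_of_le_one_left (by positivity) hσ1
  have hS : ∀ n, ∑ i ∈ Finset.range n, (∫ ε, path b H i ε 1 ∂signMeasure b H) ^ 2 ≤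
      (1 - r ^ 2)⁻¹ := by
    intro n
    have h1 := (hasSum_geometric_of_lt_one (sq_nonneg r) hr2)
    refine le_trans (Finset.sum_le_sum fun i _ ↦ ?_)
      (sum_le_hasSum (Finset.range n) (fun i _ ↦ by positivity) h1)
    rw [← pow_mul, mul_comm, pow_mul]
    exact sq_le_sq' (by linarith [neg_le_of_abs_le (hm i)]) (le_of_abs_le (hm i))
  have hb1 : ∀ n (x : ℝ), |x| = 1 → ∫ ε, Real.exp (x * path b H n ε 1) ∂signMeasure b H ≤
      Real.exp (1 + (1 - r ^ 2)⁻¹ / 2) := by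
    intro n x hx
    refine (integral_exp_path_one_le hb hH n x).trans (Real.exp_le_exp.2 ?_)
    have h1 : x * ∫ ε, path b H n ε 1 ∂signMeasure b H ≤ 1 := by
      refine (le_abs_self _).trans ?_
      rw [abs_mul, hx, one_mul]
      exact (hm n).trans (pow_le_one₀ hr0 hr1.le)
    have h2 : x ^ 2 = 1 := by rw [← sq_abs, hx, one_pow]
    rw [h2, mul_one]
    linarith [hS n]
  have hc : ∀ n, Continuous fun ε ↦ path b H n ε 1 := fun n ↦ continuous_path_apply b H n 1
  refine ⟨Real.exp (1 + (1 - r ^ 2)⁻¹ / 2) + Real.exp (1 + (1 - r ^ 2)⁻¹ / 2), fun n ↦ ?_⟩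
  rw [integral_add (integrable_of_continuous hb hH (hc n).rexp)
    (integrable_of_continuous hb hH (hc n).fun_neg.rexp)]
  have e1 := hb1 n 1 (by simp)
  have e2 := hb1 n (-1) (by simp)
  simp only [one_mul, neg_mul] at e1 e2
  exact add_le_add e1 e2

lemma abs_pow_le_factorial_mul (x : ℝ) (k : ℕ) :
    |x| ^ k ≤ k.factorial * (Real.exp x + Real.exp (-x)) := by
  have h := Real.pow_div_factorial_le_exp |x| (abs_nonneg x) k
  rw [div_le_iff₀' (by positivity)] at h
  refine h.trans (mul_le_mul_of_nonneg_left ?_ (by positivity))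
  rcases abs_choice x with h | h <;> rw [h]
  · linarith [Real.exp_pos (-x)]
  · linarith [Real.exp_pos x]

lemma exists_integral_abs_pow_le {b : ℕ} (hb : 2 ≤ b) {H : ℝ} (hH : H < 1 / 2) (k : ℕ) :
    ∃ C, ∀ n, ∫ ε, |path b H n ε 1| ^ k ∂signMeasure b H ≤ C := by
  obtain ⟨C, hC⟩ := exists_integral_exp_le hb hH
  have hc : ∀ n, Continuous fun ε ↦ path b H n ε 1 := fun n ↦ continuous_path_apply b H n 1
  refine ⟨k.factorial * C, fun n ↦ ?_⟩
  refine le_trans ?_ (mul_le_mul_of_nonneg_left (hC n) (by positivity))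
  rw [← integral_const_mul]
  exact integral_mono (integrable_of_continuous hb hH ((hc n).abs.pow k))
    (integrable_of_continuous hb hH (((hc n).rexp.add (hc n).neg.rexp).const_mul _))
    fun ε ↦ abs_pow_le_factorial_mul _ k

/-! ### The central limit theorem for the end point -/

/-- The joint characteristic function of the normalised cascade at the times `t k`. -/
noncomputable def pathChar (b : ℕ) (H : ℝ) (n : ℕ) {ι : Type*} [Fintype ι] (x : ι → ℝ)
    (t : ι → unitInterval) : ℂ :=
  ∫ ε, Complex.exp (((∑ k, x k * path b H n ε (t k) : ℝ) : ℂ) * Complex.I) ∂signMeasure b H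

lemma norm_pathChar_le_one {b : ℕ} (hb : 2 ≤ b) {H : ℝ} (hH : H < 1 / 2) (n : ℕ) {ι : Type*}
    [Fintype ι] (x : ι → ℝ) (t : ι → unitInterval) : ‖pathChar b H n x t‖ ≤ 1 := by
  have := isProbabilityMeasure_signMeasure hb hH
  refine (norm_integral_le_integral_norm _).trans ?_
  simp only [Complex.norm_exp_ofReal_mul_I]
  simp

lemma pathChar_succ {b : ℕ} (hb : 2 ≤ b) {H : ℝ} (hH : H < 1 / 2) (n : ℕ) {ι : Type*}
    [Fintype ι] (x : ι → ℝ) (t : ι → unitInterval) :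
    pathChar b H (n + 1) x t = ∏ j : Fin b,
      ((((1 + (b : ℝ) ^ (H - 1)) / 2 : ℝ) : ℂ) *
          pathChar b H n (fun k ↦ (√b)⁻¹ * x k) (fun k ↦ zoom b j (t k)) +
        (((1 - (b : ℝ) ^ (H - 1)) / 2 : ℝ) : ℂ) *
          pathChar b H n (fun k ↦ -((√b)⁻¹ * x k)) (fun k ↦ zoom b j (t k))) := by
  have hc := fun s ↦ continuous_path_apply b H n s
  obtain ⟨G, hG⟩ : ∃ G : Fin b → (List (Fin b) → ℝ) → ℂ, G = fun (j : Fin b) ε ↦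
      Complex.exp (((∑ k, (ε [] * ((√b)⁻¹ * x k)) * path b H n ε (zoom b j (t k)) : ℝ) : ℂ) * Complex.I) := ⟨_, rfl⟩
  have h1 : ∀ ε : List (Fin b) → ℝ,
      Complex.exp (((∑ k, x k * path b H (n + 1) ε (t k) : ℝ) : ℂ) * Complex.I) =
      ∏ j : Fin b, G j (shift j ε) := by
    intro ε
    simp only [hG]
    rw [← Complex.exp_sum, ← Finset.sum_mul, ← Complex.ofReal_sum, Finset.sum_comm]
    congr 3
    refine Finset.sum_congr rfl fun k _ ↦ ?_
    rw [path_succ hb, Finset.mul_sum]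
    refine Finset.sum_congr rfl fun j _ ↦ ?_
    simp only [shift]
    ring
  simp only [pathChar]
  rw [integral_congr_ae (ae_of_all _ h1), integral_prod_shift hb hH (by rw [hG]; fun_prop), hG]
  refine Finset.prod_congr rfl fun j _ ↦ ?_
  rw [integral_root hb hH (f := fun y ε ↦ Complex.exp (((∑ k, (y *
        ((√b)⁻¹ * x k)) * path b H n ε (zoom b j (t k)) : ℝ) : ℂ) * Complex.I))
    (by fun_prop) (by simp [path_update_root])]
  simp only [one_mul, neg_one_mul, Complex.real_smul]

lemma norm_pow_sub_pow_le {z w : ℂ} (hz : ‖z‖ ≤ 1) (hw : ‖w‖ ≤ 1) (k : ℕ) :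
    ‖z ^ k - w ^ k‖ ≤ k * ‖z - w‖ := by
  induction k with
  | zero => simp
  | succ k ih =>
    have e : z ^ (k + 1) - w ^ (k + 1) = z * (z ^ k - w ^ k) + (z - w) * w ^ k := by ring
    rw [e]
    refine (norm_add_le _ _).trans ?_
    rw [norm_mul, norm_mul, norm_pow]
    have h1 : ‖z‖ * ‖z ^ k - w ^ k‖ ≤ 1 * (k * ‖z - w‖) := by gcongr
    have h2 : ‖z - w‖ * ‖w‖ ^ k ≤ ‖z - w‖ * 1 := by
      gcongr
      exact pow_le_one₀ (norm_nonneg _) hw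
    push_cast
    linarith

/-- The characteristic function of the end point. -/
noncomputable def endChar (b : ℕ) (H : ℝ) (n : ℕ) (x : ℝ) : ℂ :=
  pathChar b H n (fun _ : Unit ↦ x) (fun _ ↦ 1)

lemma norm_endChar_le_one {b : ℕ} (hb : 2 ≤ b) {H : ℝ} (hH : H < 1 / 2) (n : ℕ) (x : ℝ) :
    ‖endChar b H n x‖ ≤ 1 := norm_pathChar_le_one hb hH _ _ _

lemma endChar_eq (b : ℕ) (H : ℝ) (n : ℕ) (x : ℝ) : endChar b H n x =
    ∫ ε, Complex.exp (((x * path b H n ε 1 : ℝ) : ℂ) * Complex.I) ∂signMeasure b H := by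
  simp [endChar, pathChar]

lemma endChar_succ {b : ℕ} (hb : 2 ≤ b) {H : ℝ} (hH : H < 1 / 2) (n : ℕ) (x : ℝ) :
    endChar b H (n + 1) x = ((((1 + (b : ℝ) ^ (H - 1)) / 2 : ℝ) : ℂ) * endChar b H n ((√b)⁻¹ * x) +
      (((1 - (b : ℝ) ^ (H - 1)) / 2 : ℝ) : ℂ) * endChar b H n (-((√b)⁻¹ * x))) ^ b := by
  simp only [endChar, pathChar_succ hb hH, zoom_one (Fin.isLt _), Finset.prod_const,
    Finset.card_univ, Fintype.card_fin]

/-- One generation multiplies the distance to the Gaussian characteristic function by at most `b`,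
but evaluates it at an argument smaller by the factor `√b`; this contracts any error of order
larger than `2` at the origin. -/
lemma norm_endChar_add_sub_le {b : ℕ} (hb : 2 ≤ b) {H : ℝ} (hH : H < 1 / 2) {n : ℕ}
    {D : ℝ → ℝ} (hD : ∀ x, D (-x) = D x) {R : ℝ}
    (h : ∀ x, |x| ≤ R → ‖endChar b H n x - Complex.exp (-(x : ℂ) ^ 2 / 2)‖ ≤ D x) (k : ℕ) (x : ℝ)
    (hx : |(√b)⁻¹ ^ k * x| ≤ R) :
    ‖endChar b H (n + k) x - Complex.exp (-(x : ℂ) ^ 2 / 2)‖ ≤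
      (b : ℝ) ^ k * D ((√b)⁻¹ ^ k * x) := by
  have hb0 : (0 : ℝ) < b := by positivity
  have hκ := rpow_bias_lt_one hb hH
  have hκ0 : 0 < (b : ℝ) ^ (H - 1) := by positivity
  induction k generalizing x with
  | zero => simpa using h x (by simpa using hx)
  | succ k ih =>
    rw [← add_assoc, endChar_succ hb hH]
    set κ := (b : ℝ) ^ (H - 1)
    set y := (√(b : ℝ))⁻¹ * x with hy
    have hyx : (√(b : ℝ))⁻¹ ^ (k + 1) * x = (√(b : ℝ))⁻¹ ^ k * y := by rw [hy]; ring
    rw [hyx] at hx ⊢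
    have hg : Complex.exp (-(x : ℂ) ^ 2 / 2) = Complex.exp (-(y : ℂ) ^ 2 / 2) ^ b := by
      rw [← Complex.exp_nat_mul]
      congr 1
      have h1 : (b : ℝ) * y ^ 2 = x ^ 2 := by
        rw [hy, mul_pow, inv_pow, Real.sq_sqrt hb0.le]; field_simp
      have h2 : (b : ℂ) * (y : ℂ) ^ 2 = (x : ℂ) ^ 2 := by exact_mod_cast h1
      linear_combination (1 / 2 : ℂ) * h2
    have hg1 : ‖Complex.exp (-(y : ℂ) ^ 2 / 2)‖ ≤ 1 := by
      have : -(y : ℂ) ^ 2 / 2 = ((-y ^ 2 / 2 : ℝ) : ℂ) := by push_cast; ring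
      rw [this, Complex.norm_exp_ofReal, Real.exp_le_one_iff]
      nlinarith [sq_nonneg y]
    have i1 := ih y hx
    have i2 := ih (-y) (by simpa using hx)
    rw [mul_neg, hD, Complex.ofReal_neg, neg_sq] at i2
    have n1 : ‖((1 + κ) / 2 : ℝ)‖ = (1 + κ) / 2 := Real.norm_of_nonneg (by linarith)
    have n2 : ‖((1 - κ) / 2 : ℝ)‖ = (1 - κ) / 2 := Real.norm_of_nonneg (by linarith)
    have hmix : ∀ (A : ℝ) (u v : ℂ), ‖u‖ ≤ A → ‖v‖ ≤ A →
        ‖(((1 + κ) / 2 : ℝ) : ℂ) * u + (((1 - κ) / 2 : ℝ) : ℂ) * v‖ ≤ A := by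
      intro A u v hu hv
      refine (norm_add_le _ _).trans ?_
      rw [norm_mul, norm_mul, Complex.norm_real, Complex.norm_real, n1, n2]
      nlinarith
    rw [hg]
    refine (norm_pow_sub_pow_le (hmix 1 _ _ (norm_endChar_le_one hb hH _ _)
      (norm_endChar_le_one hb hH _ _)) hg1 b).trans ?_
    rw [pow_succ' (b : ℝ), mul_assoc]
    refine mul_le_mul_of_nonneg_left ?_ hb0.le
    have e : (((1 + κ) / 2 : ℝ) : ℂ) * endChar b H (n + k) y +
        (((1 - κ) / 2 : ℝ) : ℂ) * endChar b H (n + k) (-y) - Complex.exp (-(y : ℂ) ^ 2 / 2) =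
        (((1 + κ) / 2 : ℝ) : ℂ) * (endChar b H (n + k) y - Complex.exp (-(y : ℂ) ^ 2 / 2)) +
        (((1 - κ) / 2 : ℝ) : ℂ) *
          (endChar b H (n + k) (-y) - Complex.exp (-(y : ℂ) ^ 2 / 2)) := by
      push_cast; ring
    rw [e]
    exact hmix _ _ _ i1 i2

lemma norm_exp_mul_I_sub_taylor_le (y : ℝ) :
    ‖Complex.exp ((y : ℂ) * Complex.I) - (1 + (y : ℂ) * Complex.I - (y : ℂ) ^ 2 / 2)‖ ≤
      4 * |y| ^ 3 := by
  rcases le_total |y| 1 with hy | hy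
  · have h := Complex.norm_exp_sub_sum_le_norm_mul_exp ((y : ℂ) * Complex.I) 3
    have hn : ‖(y : ℂ) * Complex.I‖ = |y| := by simp
    rw [hn] at h
    have e : ∑ m ∈ Finset.range 3, ((y : ℂ) * Complex.I) ^ m / (m.factorial : ℂ) =
        1 + (y : ℂ) * Complex.I - (y : ℂ) ^ 2 / 2 := by
      simp only [Finset.sum_range_succ, Finset.sum_range_zero]
      norm_num [Nat.factorial, mul_pow]
      ring
    rw [e] at h
    refine h.trans ?_
    rw [mul_comm]
    gcongr
    have := Real.exp_one_lt_d9
    linarith [Real.exp_le_exp.2 hy]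
  · refine (norm_sub_le _ _).trans ?_
    rw [Complex.norm_exp_ofReal_mul_I]
    have h1 : ‖1 + (y : ℂ) * Complex.I - (y : ℂ) ^ 2 / 2‖ ≤ 1 + |y| + |y| ^ 2 / 2 := by
      refine (norm_sub_le _ _).trans (add_le_add ((norm_add_le _ _).trans (by simp)) (by simp))
    have h2 : 1 ≤ |y| ^ 3 := one_le_pow₀ hy
    have h3 : |y| ≤ |y| ^ 3 := le_self_pow₀ hy (by norm_num)
    have h4 : |y| ^ 2 ≤ |y| ^ 3 := pow_le_pow_right₀ hy (by norm_num)
    linarith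

/-- Third-order Taylor bound for the distance to the Gaussian characteristic function, uniform in
the generation. -/
lemma exists_norm_endChar_sub_le {b : ℕ} (hb : 2 ≤ b) {H : ℝ} (hH : H < 1 / 2) :
    ∃ C, ∀ n (x : ℝ), |x| ≤ 1 → ‖endChar b H n x - Complex.exp (-(x : ℂ) ^ 2 / 2)‖ ≤
      |∫ ε, path b H n ε 1 ∂signMeasure b H| * |x| +
        |∫ ε, path b H n ε 1 ^ 2 ∂signMeasure b H - 1| * |x| ^ 2 + C * |x| ^ 3 := by
  have := isProbabilityMeasure_signMeasure hb hH
  obtain ⟨C, hC⟩ := exists_integral_abs_pow_le hb hH 3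
  refine ⟨4 * C + 1, fun n x hx ↦ ?_⟩
  have hc := continuous_path_apply b H n 1
  set m := ∫ ε, path b H n ε 1 ∂signMeasure b H with hm
  set v := ∫ ε, path b H n ε 1 ^ 2 ∂signMeasure b H with hv
  have hT : ∫ ε, (1 + ((x * path b H n ε 1 : ℝ) : ℂ) * Complex.I -
      ((x * path b H n ε 1 : ℝ) : ℂ) ^ 2 / 2) ∂signMeasure b H =
      1 + (x : ℂ) * m * Complex.I - (x : ℂ) ^ 2 * v / 2 := by
    rw [integral_sub (integrable_of_continuous hb hH (by fun_prop))
      (integrable_of_continuous hb hH (by fun_prop)),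
      integral_add (integrable_of_continuous hb hH (by fun_prop))
      (integrable_of_continuous hb hH (by fun_prop)), integral_mul_const, integral_div]
    simp only [← Complex.ofReal_pow, integral_complex_ofReal, mul_pow, integral_const_mul]
    rw [← hm, ← hv]
    simp
  have h1 : ‖endChar b H n x - (1 + (x : ℂ) * m * Complex.I - (x : ℂ) ^ 2 * v / 2)‖ ≤
      4 * C * |x| ^ 3 := by
    rw [endChar_eq, ← hT, ← integral_sub (integrable_of_continuous hb hH (by fun_prop))
      (integrable_of_continuous hb hH (by fun_prop))]
    refine (norm_integral_le_integral_norm _).trans ?_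
    calc _ ≤ ∫ ε, (4 * |x| ^ 3) * |path b H n ε 1| ^ 3 ∂signMeasure b H := by
          refine integral_mono (integrable_of_continuous hb hH (by fun_prop))
            (integrable_of_continuous hb hH (by fun_prop)) fun ε ↦ ?_
          refine (norm_exp_mul_I_sub_taylor_le _).trans (le_of_eq ?_)
          rw [abs_mul, mul_pow, mul_assoc]
      _ ≤ _ := by
          rw [integral_const_mul]
          nlinarith [hC n, pow_nonneg (abs_nonneg x) 3]
  have h2 : ‖Complex.exp (-(x : ℂ) ^ 2 / 2) - 1 - (-(x : ℂ) ^ 2 / 2)‖ ≤ |x| ^ 3 := by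
    have hn : ‖-(x : ℂ) ^ 2 / 2‖ = |x| ^ 2 / 2 := by simp
    have hx2 : |x| ^ 2 ≤ 1 := pow_le_one₀ (abs_nonneg x) hx
    refine (Complex.norm_exp_sub_one_sub_id_le (by rw [hn]; linarith)).trans ?_
    rw [hn]
    nlinarith [pow_nonneg (abs_nonneg x) 3, pow_nonneg (abs_nonneg x) 4]
  have e : endChar b H n x - Complex.exp (-(x : ℂ) ^ 2 / 2) =
      (endChar b H n x - (1 + (x : ℂ) * m * Complex.I - (x : ℂ) ^ 2 * v / 2)) -
      (Complex.exp (-(x : ℂ) ^ 2 / 2) - 1 - (-(x : ℂ) ^ 2 / 2)) +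
      ((m : ℂ) * x * Complex.I - ((v - 1 : ℝ) : ℂ) * (x : ℂ) ^ 2 / 2) := by
    push_cast; ring
  rw [e]
  have h3 : ‖(m : ℂ) * x * Complex.I - ((v - 1 : ℝ) : ℂ) * (x : ℂ) ^ 2 / 2‖ ≤
      |m| * |x| + |v - 1| * |x| ^ 2 := by
    refine (norm_sub_le _ _).trans ?_
    simp only [norm_mul, norm_div, norm_pow, Complex.norm_real, Complex.norm_I, mul_one,
      Real.norm_eq_abs, Complex.norm_ofNat]
    nlinarith [mul_nonneg (abs_nonneg (v - 1)) (pow_nonneg (abs_nonneg x) 2)]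
  refine (norm_add_le _ _).trans ((add_le_add ((norm_sub_le _ _).trans
    (add_le_add h1 h2)) h3).trans (le_of_eq (by ring)))

/-- The end point of the normalised cascade is asymptotically standard Gaussian. -/
lemma tendsto_endChar {b : ℕ} (hb : 2 ≤ b) {H : ℝ} (hH : H < 1 / 2) (x : ℝ) :
    Tendsto (fun n ↦ endChar b H n x) atTop (𝓝 (Complex.exp (-(x : ℂ) ^ 2 / 2))) := by
  obtain ⟨C, hC⟩ := exists_norm_endChar_sub_le hb hH
  have hb0 : (0 : ℝ) < b := by positivity
  have hc1 : (√(b : ℝ))⁻¹ < 1 := by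
    apply inv_lt_one_of_one_lt₀
    rw [Real.lt_sqrt zero_le_one]
    norm_num
    omega
  have hc := tendsto_pow_atTop_nhds_zero_of_lt_one (by positivity) hc1
  have hbc : ∀ k : ℕ, (b : ℝ) ^ k * ((√(b : ℝ))⁻¹ ^ k) ^ 2 = 1 := by
    intro k
    rw [← pow_mul, mul_comm k, pow_mul, inv_pow, Real.sq_sqrt hb0.le, ← mul_pow,
      mul_inv_cancel₀ hb0.ne', one_pow]
  rw [Metric.tendsto_atTop']
  intro δ hδ
  -- the number `k` of contraction steps is fixed before `n` tends to infinity
  have hk1 : ∀ᶠ k in atTop, (√(b : ℝ))⁻¹ ^ k * |x| < 1 := by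
    have := hc.mul_const |x|
    rw [zero_mul] at this
    exact this.eventually (gt_mem_nhds one_pos)
  have hk2 : ∀ᶠ k in atTop, (√(b : ℝ))⁻¹ ^ k * (C * |x| ^ 3) < δ / 2 := by
    have := hc.mul_const (C * |x| ^ 3)
    rw [zero_mul] at this
    exact this.eventually (gt_mem_nhds (half_pos hδ))
  obtain ⟨k, hk1, hk2⟩ := (hk1.and hk2).exists
  set c := (√(b : ℝ))⁻¹ ^ k with hcdef
  have hc0 : 0 < c := by positivity
  have hn : ∀ᶠ n in atTop, |∫ ε, path b H n ε 1 ∂signMeasure b H| * (b ^ k * (c * |x|)) +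
      |∫ ε, path b H n ε 1 ^ 2 ∂signMeasure b H - 1| * |x| ^ 2 < δ / 2 := by
    have h1 := (tendsto_integral_path_one hb hH).abs.mul_const ((b : ℝ) ^ k * (c * |x|))
    have h2 := ((tendsto_integral_path_one_sq hb hH).sub_const 1).abs.mul_const (|x| ^ 2)
    have h3 := h1.add h2
    simp only [abs_zero, zero_mul, sub_self, add_zero] at h3
    exact h3.eventually (gt_mem_nhds (half_pos hδ))
  obtain ⟨N, hN⟩ := eventually_atTop.1 hn
  refine ⟨N + k, fun n hnk ↦ ?_⟩
  obtain ⟨n, rfl⟩ : ∃ n', n = n' + k := ⟨n - k, by omega⟩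
  have hcx : |c * x| = c * |x| := by rw [abs_mul, abs_of_pos hc0]
  have h := norm_endChar_add_sub_le hb hH (n := n) (R := 1)
    (D := fun x ↦ |∫ ε, path b H n ε 1 ∂signMeasure b H| * |x| +
        |∫ ε, path b H n ε 1 ^ 2 ∂signMeasure b H - 1| * |x| ^ 2 + C * |x| ^ 3)
    (by simp) (hC n) k x (by rw [← hcdef, hcx]; exact hk1.le)
  rw [← hcdef] at h
  simp only [hcx] at h
  rw [dist_eq_norm]
  refine h.trans_lt ?_
  have h1 := hN n (by omega)
  have h2 := hbc k
  rw [← hcdef] at h2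
  have e : (b : ℝ) ^ k * (|∫ ε, path b H n ε 1 ∂signMeasure b H| * (c * |x|) +
        |∫ ε, path b H n ε 1 ^ 2 ∂signMeasure b H - 1| * (c * |x|) ^ 2 + C * (c * |x|) ^ 3) =
      (|∫ ε, path b H n ε 1 ∂signMeasure b H| * (b ^ k * (c * |x|)) +
        |∫ ε, path b H n ε 1 ^ 2 ∂signMeasure b H - 1| * |x| ^ 2) + c * (C * |x| ^ 3) := by
    linear_combination (|∫ ε, path b H n ε 1 ^ 2 ∂signMeasure b H - 1| * |x| ^ 2 +
      c * C * |x| ^ 3) * h2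
  rw [e]
  linarith

/-! ### Convergence of the finite-dimensional distributions at `b`-adic times -/

/-- The joint characteristic function of Brownian motion at the times `t k`. -/
noncomputable def brownianChar {ι : Type*} [Fintype ι] (x : ι → ℝ) (t : ι → unitInterval) : ℂ :=
  Complex.exp ((-(∑ k, ∑ l, x k * x l * ((min (t k) (t l) : unitInterval) : ℝ)) / 2 : ℝ) : ℂ)

lemma sum_range_clamp (m : ℕ) {y : ℝ} (hy : 0 ≤ y) :
    ∑ j ∈ Finset.range m, max 0 (min 1 (y - j)) = min (m : ℝ) y := by
  induction m with
  | zero => simp [hy]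
  | succ m ih =>
    rw [Finset.sum_range_succ, ih]
    push_cast
    rcases le_total y m with h | h
    · rw [min_eq_right h, max_eq_left ((min_le_right _ _).trans (by linarith)),
        min_eq_right (by linarith), add_zero]
    · rw [min_eq_left h, max_eq_right (le_min zero_le_one (by linarith))]
      rcases le_total y (m + 1) with h' | h'
      · rw [min_eq_right (by linarith), min_eq_right h']; ring
      · rw [min_eq_left (by linarith), min_eq_left h']

lemma sum_zoom (b : ℕ) (t : unitInterval) : ∑ j : Fin b, (zoom b j t : ℝ) = b * t := by
  have h0 := t.2.1
  have h1 := t.2.2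
  rw [Fin.sum_univ_eq_sum_range (fun j ↦ (zoom b j t : ℝ)) b]
  simp only [coe_zoom]
  rw [sum_range_clamp b (by positivity), min_eq_right]
  exact mul_le_of_le_one_right (by positivity) h1

lemma monotone_zoom (b j : ℕ) : Monotone (zoom b j) := by
  intro s t hst
  refine Set.monotone_projIcc _ ?_
  have : (s : ℝ) ≤ t := hst
  gcongr

/-- The self-similarity relation of `path_succ` is also satisfied by Brownian motion. -/
lemma prod_brownianChar_zoom {b : ℕ} (hb : 2 ≤ b) {ι : Type*} [Fintype ι] (x : ι → ℝ)
    (t : ι → unitInterval) :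
    ∏ j : Fin b, brownianChar (fun k ↦ (√b)⁻¹ * x k) (fun k ↦ zoom b j (t k)) =
      brownianChar x t := by
  have hb0 : (0 : ℝ) < b := by positivity
  simp only [brownianChar, ← Complex.exp_sum, ← Complex.ofReal_sum]
  congr 2
  rw [← Finset.sum_div, Finset.sum_neg_distrib, Finset.sum_comm]
  congr 2
  refine Finset.sum_congr rfl fun k _ ↦ ?_
  rw [Finset.sum_comm]
  refine Finset.sum_congr rfl fun l _ ↦ ?_
  simp only [← (monotone_zoom b _).map_min]
  rw [← Finset.mul_sum, sum_zoom]
  have h : (√(b : ℝ))⁻¹ * (√(b : ℝ))⁻¹ * b = 1 := by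
    rw [← mul_inv, Real.mul_self_sqrt hb0.le, inv_mul_cancel₀ hb0.ne']
  linear_combination (x k * x l * ((min (t k) (t l) : unitInterval) : ℝ)) * h

lemma brownianChar_neg {ι : Type*} [Fintype ι] (x : ι → ℝ) (t : ι → unitInterval) :
    brownianChar (fun k ↦ -x k) t = brownianChar x t := by
  simp [brownianChar]

lemma zoom_mul_pow {b : ℕ} (hb : 2 ≤ b) (j m : ℕ) {t : unitInterval} {i : ℕ}
    (h : (t : ℝ) * (b : ℝ) ^ (m + 1) = i) :
    (zoom b j t : ℝ) * (b : ℝ) ^ m = (min (b ^ m) (i - j * b ^ m) : ℕ) := by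
  have hb0 : (0 : ℝ) < b := by positivity
  have hp : (0 : ℝ) < (b : ℝ) ^ m := by positivity
  have h1 : ((b : ℝ) * t - j) * (b : ℝ) ^ m = i - j * (b : ℝ) ^ m := by
    rw [← h]; ring
  rw [coe_zoom, max_mul_of_nonneg _ _ hp.le, min_mul_of_nonneg _ _ hp.le, h1, zero_mul, one_mul,
    Nat.cast_min, Nat.cast_pow]
  rcases le_total i (j * b ^ m) with hi | hi
  · have hi' : (i : ℝ) ≤ j * (b : ℝ) ^ m := by exact_mod_cast hi
    rw [Nat.sub_eq_zero_of_le hi, Nat.cast_zero, min_eq_right (a := (b : ℝ) ^ m) hp.le,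
      max_eq_left]
    exact (min_le_right _ _).trans (by linarith)
  · have hi' : (j : ℝ) * (b : ℝ) ^ m ≤ i := by exact_mod_cast hi
    rw [Nat.cast_sub hi, max_eq_right]
    · push_cast; rfl
    · exact le_min hp.le (by linarith)

lemma tendsto_pathChar {b : ℕ} (hb : 2 ≤ b) {H : ℝ} (hH : H < 1 / 2) (m : ℕ) {ι : Type*}
    [Fintype ι] (x : ι → ℝ) (t : ι → unitInterval)
    (ht : ∀ k, ∃ i : ℕ, (t k : ℝ) * (b : ℝ) ^ m = i) :
    Tendsto (fun n ↦ pathChar b H n x t) atTop (𝓝 (brownianChar x t)) := by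
  induction m generalizing x t with
  | zero =>
    have h01 : ∀ k, t k = 0 ∨ t k = 1 := by
      intro k
      obtain ⟨i, hi⟩ := ht k
      rw [pow_zero, mul_one] at hi
      have h1 : (i : ℝ) ≤ 1 := hi ▸ (t k).2.2
      have h2 : i ≤ 1 := by exact_mod_cast h1
      interval_cases i
      · left; exact Subtype.ext (by simpa using hi)
      · right; exact Subtype.ext (by simpa using hi)
    have h1 : ∀ n, pathChar b H n x t = endChar b H n (∑ k, x k * t k) := by
      intro n
      rw [endChar_eq, pathChar]
      congr 1 with ε
      congr 3
      rw [Finset.sum_mul]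
      refine Finset.sum_congr rfl fun k _ ↦ ?_
      rcases h01 k with h | h <;> rw [h]
      · simp [path_apply_zero hb]
      · simp
    have h2 : brownianChar x t = Complex.exp (-((∑ k, x k * t k : ℝ) : ℂ) ^ 2 / 2) := by
      rw [brownianChar, sq (((∑ k, x k * t k : ℝ) : ℂ)), ← Complex.ofReal_mul,
        Finset.sum_mul_sum]
      push_cast
      congr 3
      refine Finset.sum_congr rfl fun k _ ↦ Finset.sum_congr rfl fun l _ ↦ ?_
      rcases h01 k with h | h <;> rcases h01 l with h' | h' <;> rw [h, h'] <;> simp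
    simp only [h1, h2]
    exact tendsto_endChar hb hH _
  | succ m ih =>
    rw [← tendsto_add_atTop_iff_nat 1]
    simp only [pathChar_succ hb hH]
    rw [← prod_brownianChar_zoom hb x t]
    refine tendsto_finsetProd _ fun j _ ↦ ?_
    have hz : ∀ k, ∃ i : ℕ, (zoom b j (t k) : ℝ) * (b : ℝ) ^ m = i := fun k ↦ by
      obtain ⟨i, hi⟩ := ht k
      exact ⟨_, zoom_mul_pow hb j m hi⟩
    have h1 := (ih (fun k ↦ (√b)⁻¹ * x k) (fun k ↦ zoom b j (t k)) hz).const_mul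
      (((1 + (b : ℝ) ^ (H - 1)) / 2 : ℝ) : ℂ)
    have h2 := (ih (fun k ↦ -((√b)⁻¹ * x k)) (fun k ↦ zoom b j (t k)) hz).const_mul
      (((1 - (b : ℝ) ^ (H - 1)) / 2 : ℝ) : ℂ)
    have h3 := h1.add h2
    rw [brownianChar_neg, ← add_mul, ← Complex.ofReal_add] at h3
    convert h3 using 2
    ring_nf
    simp

/-! ### Fourth moments of the increments -/

lemma integral_root_mul_pow_four {b : ℕ} (hb : 2 ≤ b) {H : ℝ} (hH : H < 1 / 2) (n : ℕ)
    (s t : unitInterval) :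
    ∫ ε, (ε [] * (path b H n ε t - path b H n ε s)) ^ 4 ∂signMeasure b H =
      ∫ ε, (path b H n ε t - path b H n ε s) ^ 4 ∂signMeasure b H := by
  have hc := fun s ↦ continuous_path_apply b H n s
  rw [integral_root hb hH (f := fun x ε ↦ (x * (path b H n ε t - path b H n ε s)) ^ 4)
    (by fun_prop) (by simp [path_update_root])]
  have : Even 4 := by decide
  simp only [one_mul, neg_mul, this.neg_pow, smul_eq_mul]
  ring

/-- The increments over `b`-adic intervals of length `b ^ (-m)` have fourth moments of order
`b ^ (-2 m)`, uniformly in the generation: by self-similarity such an increment is, up to its sign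
and the factor `b ^ (-1/2)`, an increment of the previous generation over an interval of length
`b ^ (-(m - 1))`. -/
lemma exists_integral_increment_pow_four_le {b : ℕ} (hb : 2 ≤ b) {H : ℝ} (hH : H < 1 / 2) :
    ∃ C, 0 ≤ C ∧ ∀ (m n i : ℕ) (s t : unitInterval), (s : ℝ) * (b : ℝ) ^ m = i →
      (t : ℝ) * (b : ℝ) ^ m = (i + 1 : ℕ) →
      ∫ ε, (path b H n ε t - path b H n ε s) ^ 4 ∂signMeasure b H ≤ C * ((b : ℝ) ^ m)⁻¹ ^ 2 := by
  have := isProbabilityMeasure_signMeasure hb hH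
  have hb0 : (0 : ℝ) < b := by positivity
  have hb1 : (1 : ℝ) ≤ b := by exact_mod_cast (by omega : 1 ≤ b)
  obtain ⟨hσ, -⟩ := sigma_sq hb hH
  obtain ⟨C, hC⟩ := exists_integral_abs_pow_le hb hH 4
  have h4 : ∀ y : ℝ, |y| ^ 4 = y ^ 4 := fun y ↦ Even.pow_abs (by decide) y
  simp only [h4] at hC
  refine ⟨max C 1, by positivity, fun m ↦ ?_⟩
  induction m with
  | zero =>
    intro n i s t hs ht
    have hi : i = 0 := by
      have h1 : ((i + 1 : ℕ) : ℝ) ≤ 1 := by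
        rw [← ht, pow_zero, mul_one]; exact t.2.2
      have h2 : i + 1 ≤ 1 := by exact_mod_cast h1
      omega
    subst hi
    have hs' : s = 0 := Subtype.ext (by simpa using hs)
    have ht' : t = 1 := Subtype.ext (by simpa using ht)
    subst hs' ht'
    simp only [path_apply_zero hb, sub_zero, pow_zero, inv_one, one_pow, mul_one]
    exact (hC n).trans (le_max_left _ _)
  | succ m ih =>
    intro n i s t hs ht
    have hp : (0 : ℝ) < (b : ℝ) ^ (m + 1) := by positivity
    cases n with
    | zero =>
      have h1 : (t : ℝ) - s = ((b : ℝ) ^ (m + 1))⁻¹ := by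
        apply eq_inv_of_mul_eq_one_left
        rw [sub_mul, hs, ht]
        push_cast; ring
      simp only [path_zero, ← mul_sub, h1, integral_const, probReal_univ, one_smul]
      have h2 : (sigma b H)⁻¹ ≤ 1 := inv_le_one_of_one_le₀ hσ
      have h3 : 0 ≤ (sigma b H)⁻¹ := by positivity
      have h5 : ((b : ℝ) ^ (m + 1))⁻¹ ≤ 1 := inv_le_one_of_one_le₀ (one_le_pow₀ hb1)
      have h6 : 0 ≤ ((b : ℝ) ^ (m + 1))⁻¹ := by positivity
      calc ((sigma b H)⁻¹ * ((b : ℝ) ^ (m + 1))⁻¹) ^ 4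
          ≤ (1 * ((b : ℝ) ^ (m + 1))⁻¹) ^ 4 := by gcongr
        _ = ((b : ℝ) ^ (m + 1))⁻¹ ^ 4 := by rw [one_mul]
        _ ≤ ((b : ℝ) ^ (m + 1))⁻¹ ^ 2 := pow_le_pow_of_le_one h6 h5 (by norm_num)
        _ ≤ _ := le_mul_of_one_le_left (by positivity) (le_max_right _ _)
    | succ n =>
      -- the letter `j` is the index of the interval of length `1 / b` that contains `[s, t]`
      obtain ⟨j, hj⟩ : ∃ j, j = i / b ^ m := ⟨_, rfl⟩
      have hpm : 0 < b ^ m := by positivity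
      have hjb : j < b := by
        rw [hj, Nat.div_lt_iff_lt_mul hpm, ← pow_succ']
        have h1 : ((i + 1 : ℕ) : ℝ) ≤ (b : ℝ) ^ (m + 1) := by
          rw [← ht]; exact mul_le_of_le_one_left hp.le t.2.2
        have h2 : i + 1 ≤ b ^ (m + 1) := by exact_mod_cast h1
        omega
      have hi := Nat.div_add_mod i (b ^ m)
      have hlt := Nat.mod_lt i hpm
      obtain ⟨r, hr⟩ : ∃ r, r = i % b ^ m := ⟨_, rfl⟩
      rw [← hj, ← hr] at hi
      rw [← hr] at hlt
      have hzs := fun j' ↦ zoom_mul_pow hb j' m hs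
      have hzt := fun j' ↦ zoom_mul_pow hb j' m ht
      have hne : ∀ j' : ℕ, j' ≠ j → zoom b j' t = zoom b j' s := by
        intro j' hj'
        apply Subtype.ext
        have hpm' : (b : ℝ) ^ m ≠ 0 := by positivity
        refine mul_right_cancel₀ hpm' ?_
        rw [hzs, hzt]
        congr 1
        rcases lt_or_gt_of_ne hj' with h | h
        · have h1 : (j' + 1) * b ^ m ≤ j * b ^ m := Nat.mul_le_mul_right _ h
          rw [add_mul, one_mul, mul_comm j] at h1
          rw [min_eq_left (by omega), min_eq_left (by omega)]
        · have h1 : (j + 1) * b ^ m ≤ j' * b ^ m := Nat.mul_le_mul_right _ h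
          rw [add_mul, one_mul, mul_comm j] at h1
          rw [Nat.sub_eq_zero_of_le (by omega), Nat.sub_eq_zero_of_le (by omega)]
      have hs' : (zoom b j s : ℝ) * (b : ℝ) ^ m = (r : ℕ) := by
        rw [hzs]
        congr 1
        rw [mul_comm j, min_eq_right (by omega)]
        omega
      have ht' : (zoom b j t : ℝ) * (b : ℝ) ^ m = (r + 1 : ℕ) := by
        rw [hzt]
        congr 1
        rw [mul_comm j, min_eq_right (by omega)]
        omega
      have hpath : ∀ ε : List (Fin b) → ℝ, path b H (n + 1) ε t - path b H (n + 1) ε s =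
          (√b)⁻¹ * (shift ⟨j, hjb⟩ ε [] * (path b H n (shift ⟨j, hjb⟩ ε) (zoom b j t) -
            path b H n (shift ⟨j, hjb⟩ ε) (zoom b j s))) := by
        intro ε
        rw [path_succ hb, path_succ hb, ← Finset.sum_sub_distrib,
          Finset.sum_eq_single (⟨j, hjb⟩ : Fin b)]
        · simp only [shift]; ring
        · intro j' _ hj'
          rw [hne j' (fun h ↦ hj' (Fin.ext h)), sub_self]
        · simp
      have hc := fun s ↦ continuous_path_apply b H n s
      simp only [hpath, mul_pow (√(b : ℝ))⁻¹]
      rw [integral_const_mul, integral_comp_shift hb hH ⟨j, hjb⟩ (f := fun ε ↦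
        (ε [] * (path b H n ε (zoom b j t) - path b H n ε (zoom b j s))) ^ 4) (by fun_prop),
        integral_root_mul_pow_four hb hH]
      have h2 : (√(b : ℝ))⁻¹ ^ 4 = (b : ℝ)⁻¹ ^ 2 := by
        rw [show 4 = 2 * 2 from rfl, pow_mul, inv_pow, Real.sq_sqrt hb0.le]
      rw [h2, pow_succ' (b : ℝ) m, mul_inv, mul_pow, mul_left_comm]
      exact mul_le_mul_of_nonneg_left (ih n _ _ _ hs' ht') (by positivity)

/-! ### Tightness -/

/-- The `b`-adic time `i / b ^ m`, for `i ≤ b ^ m`. -/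
noncomputable def node (b m i : ℕ) : unitInterval :=
  Set.projIcc 0 1 zero_le_one ((i : ℝ) / (b : ℝ) ^ m)

lemma coe_node {b : ℕ} (hb : 2 ≤ b) {m i : ℕ} (hi : i ≤ b ^ m) :
    (node b m i : ℝ) = (i : ℝ) / (b : ℝ) ^ m := by
  have hb0 : (0 : ℝ) < b := by positivity
  have h1 : (i : ℝ) / (b : ℝ) ^ m ≤ 1 := by
    rw [div_le_one (by positivity)]; exact_mod_cast hi
  rw [node, Set.projIcc_of_mem _ ⟨by positivity, h1⟩]

lemma node_mul {b : ℕ} (hb : 2 ≤ b) {m i : ℕ} (hi : i ≤ b ^ m) :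
    (node b m i : ℝ) * (b : ℝ) ^ m = i := by
  have hb0 : (0 : ℝ) < b := by positivity
  rw [coe_node hb hi]
  field_simp

lemma floor_mul_pow_le (b m : ℕ) (t : unitInterval) : ⌊(t : ℝ) * (b : ℝ) ^ m⌋₊ ≤ b ^ m := by
  refine Nat.floor_le_of_le ?_
  push_cast
  exact mul_le_of_le_one_left (by positivity) t.2.2

lemma tendsto_node_floor {b : ℕ} (hb : 2 ≤ b) (t : unitInterval) :
    Tendsto (fun m ↦ node b m ⌊(t : ℝ) * (b : ℝ) ^ m⌋₊) atTop (𝓝 t) := by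
  have hb1 : (1 : ℝ) < b := by exact_mod_cast hb
  rw [tendsto_subtype_rng]
  have h1 := (tendsto_nat_floor_mul_div_atTop (R := ℝ) t.2.1).comp
    (tendsto_pow_atTop_atTop_of_one_lt hb1)
  refine h1.congr fun m ↦ ?_
  rw [coe_node hb (floor_mul_pow_le _ _ _)]
  rfl

/-- The continuous functions vanishing at `0` whose `b`-adic increments of level `m ≥ M` are
bounded by `(9 / 10) ^ m`. Any ratio in the interval `(b ^ (-1/4), 1)` would serve. -/
def smallIncrements (b M : ℕ) : Set C(unitInterval, ℝ) :=
  {f | f 0 = 0 ∧ ∀ m, M ≤ m → ∀ i < b ^ m,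
    |f (node b m (i + 1)) - f (node b m i)| ≤ (9 / 10 : ℝ) ^ m}

lemma isClosed_smallIncrements (b M : ℕ) : IsClosed (smallIncrements b M) := by
  have h : ∀ t : unitInterval, Continuous fun f : C(unitInterval, ℝ) ↦ f t :=
    fun t ↦ continuous_eval_const t
  simp only [smallIncrements, Set.ofPred_and, Set.ofPred_forall]
  refine (isClosed_eq (h 0) continuous_const).inter ?_
  refine isClosed_iInter fun m ↦ isClosed_iInter fun _ ↦ isClosed_iInter fun i ↦
    isClosed_iInter fun _ ↦ ?_
  exact isClosed_le ((h _).sub (h _)).abs continuous_const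

section Chaining

variable {b M : ℕ} {f : C(unitInterval, ℝ)}

lemma abs_sub_node_le (hf : f ∈ smallIncrements b M) {m : ℕ} (hm : M ≤ m) {a d : ℕ}
    (hd : a + d ≤ b ^ m) :
    |f (node b m (a + d)) - f (node b m a)| ≤ d * (9 / 10 : ℝ) ^ m := by
  induction d with
  | zero => simp
  | succ d ih =>
    have h1 := ih (by omega)
    have h2 := hf.2 m hm (a + d) (by omega)
    have e : f (node b m (a + (d + 1))) - f (node b m a) =
        (f (node b m (a + d + 1)) - f (node b m (a + d))) +
          (f (node b m (a + d)) - f (node b m a)) := by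
      rw [← add_assoc]; ring
    rw [e]
    refine (abs_add_le _ _).trans ?_
    push_cast
    linarith

lemma abs_sub_node_floor_succ_le (hb : 2 ≤ b) (hf : f ∈ smallIncrements b M) {m : ℕ} (hm : M ≤ m)
    (t : unitInterval) :
    |f (node b m ⌊(t : ℝ) * (b : ℝ) ^ m⌋₊) -
      f (node b (m + 1) ⌊(t : ℝ) * (b : ℝ) ^ (m + 1)⌋₊)| ≤ b * (9 / 10 : ℝ) ^ m := by
  have hb0 : (0 : ℝ) < b := by positivity
  have ht := t.2.1
  obtain ⟨k, hk⟩ : ∃ k, k = ⌊(t : ℝ) * (b : ℝ) ^ m⌋₊ := ⟨_, rfl⟩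
  obtain ⟨l, hl⟩ : ∃ l, l = ⌊(t : ℝ) * (b : ℝ) ^ (m + 1)⌋₊ := ⟨_, rfl⟩
  have hkm : k ≤ b ^ m := hk ▸ floor_mul_pow_le b m t
  have hlm : l ≤ b ^ (m + 1) := hl ▸ floor_mul_pow_le b (m + 1) t
  rw [← hk, ← hl]
  have hkl : k * b ≤ l := by
    rw [hl]
    refine Nat.le_floor ?_
    push_cast
    rw [pow_succ, ← mul_assoc]
    gcongr
    rw [hk]
    exact Nat.floor_le (by positivity)
  have hlk : l ≤ k * b + b := by
    have h1 : (t : ℝ) * (b : ℝ) ^ m < k + 1 := by rw [hk]; exact Nat.lt_floor_add_one _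
    have h2 : (l : ℝ) ≤ (t : ℝ) * (b : ℝ) ^ (m + 1) := by
      rw [hl]; exact Nat.floor_le (by positivity)
    have h3 : (l : ℝ) < (k * b + b : ℕ) := by
      push_cast
      rw [pow_succ] at h2
      nlinarith
    exact_mod_cast h3.le
  obtain ⟨d, rfl⟩ := Nat.exists_eq_add_of_le hkl
  have hd : (d : ℝ) ≤ b := by exact_mod_cast (by omega : d ≤ b)
  have e : node b m k = node b (m + 1) (k * b) := by
    apply Subtype.ext
    rw [coe_node hb hkm, coe_node hb (by omega)]
    push_cast
    field_simp
    ring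
  rw [e, abs_sub_comm]
  refine (abs_sub_node_le hf (by omega : M ≤ m + 1) hlm).trans ?_
  have h9 : (9 / 10 : ℝ) ^ (m + 1) ≤ (9 / 10 : ℝ) ^ m :=
    pow_le_pow_of_le_one (by norm_num) (by norm_num) (by omega)
  gcongr

/-- Chaining along the `b`-adic approximations of `t` from below. -/
lemma abs_sub_node_floor_le (hb : 2 ≤ b) (hf : f ∈ smallIncrements b M) {m : ℕ} (hm : M ≤ m)
    (t : unitInterval) :
    |f (node b m ⌊(t : ℝ) * (b : ℝ) ^ m⌋₊) - f t| ≤ 10 * b * (9 / 10 : ℝ) ^ m := by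
  have hu : ∀ k, dist (f (node b (m + k) ⌊(t : ℝ) * (b : ℝ) ^ (m + k)⌋₊))
      (f (node b (m + (k + 1)) ⌊(t : ℝ) * (b : ℝ) ^ (m + (k + 1))⌋₊)) ≤
      (b * (9 / 10 : ℝ) ^ m) * (9 / 10 : ℝ) ^ k := by
    intro k
    rw [Real.dist_eq, mul_assoc, ← pow_add]
    exact abs_sub_node_floor_succ_le hb hf (by omega : M ≤ m + k) t
  have hlim : Tendsto (fun k ↦ f (node b (m + k) ⌊(t : ℝ) * (b : ℝ) ^ (m + k)⌋₊)) atTop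
      (𝓝 (f t)) := by
    simp only [add_comm m]
    exact (f.continuous.tendsto t).comp ((tendsto_node_floor hb t).comp (tendsto_add_atTop_nat m))
  have h := dist_le_of_le_geometric_of_tendsto₀ _ _ (by norm_num) hu hlim
  rw [Real.dist_eq, add_zero] at h
  refine h.trans (le_of_eq ?_)
  ring

lemma abs_sub_le_of_smallIncrements (hb : 2 ≤ b) (hf : f ∈ smallIncrements b M) {m : ℕ}
    (hm : M ≤ m) {s t : unitInterval} (hst : |(s : ℝ) - t| < ((b : ℝ) ^ m)⁻¹) :
    |f s - f t| ≤ (20 * b + 1) * (9 / 10 : ℝ) ^ m := by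
  wlog h : (s : ℝ) ≤ t generalizing s t
  · rw [abs_sub_comm]
    exact this (by rwa [abs_sub_comm]) (le_of_not_ge h)
  have hb0 : (0 : ℝ) < b := by positivity
  have hp : (0 : ℝ) < (b : ℝ) ^ m := by positivity
  have hs0 := s.2.1
  have ht0 := t.2.1
  have h1 := abs_sub_node_floor_le hb hf hm s
  have h2 := abs_sub_node_floor_le hb hf hm t
  obtain ⟨k, hk⟩ : ∃ k, k = ⌊(s : ℝ) * (b : ℝ) ^ m⌋₊ := ⟨_, rfl⟩
  obtain ⟨l, hl⟩ : ∃ l, l = ⌊(t : ℝ) * (b : ℝ) ^ m⌋₊ := ⟨_, rfl⟩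
  have hlm : l ≤ b ^ m := hl ▸ floor_mul_pow_le b m t
  rw [← hk] at h1
  rw [← hl] at h2
  have hkl : k ≤ l := by
    rw [hk, hl]
    exact Nat.floor_le_floor (by gcongr)
  have hlk : l ≤ k + 1 := by
    have h3 : (s : ℝ) * (b : ℝ) ^ m < k + 1 := by rw [hk]; exact Nat.lt_floor_add_one _
    have h4 : (l : ℝ) ≤ (t : ℝ) * (b : ℝ) ^ m := by
      rw [hl]; exact Nat.floor_le (by positivity)
    have h5 : ((t : ℝ) - s) * (b : ℝ) ^ m < 1 := by
      rw [abs_sub_comm, abs_of_nonneg (by linarith)] at hst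
      calc ((t : ℝ) - s) * (b : ℝ) ^ m < ((b : ℝ) ^ m)⁻¹ * (b : ℝ) ^ m := by gcongr
        _ = 1 := inv_mul_cancel₀ hp.ne'
    have h6 : (l : ℝ) < (k + 1 + 1 : ℕ) := by push_cast; linarith
    have h7 : l < k + 1 + 1 := by exact_mod_cast h6
    omega
  obtain ⟨d, rfl⟩ := Nat.exists_eq_add_of_le hkl
  have h3 := abs_sub_node_le hf hm hlm
  have hd : (d : ℝ) ≤ 1 := by exact_mod_cast (by omega : d ≤ 1)
  have h9 : (0 : ℝ) < (9 / 10 : ℝ) ^ m := by positivity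
  rw [abs_le] at h1 h2 h3 ⊢
  constructor <;> nlinarith

lemma abs_le_of_smallIncrements (hb : 2 ≤ b) (hf : f ∈ smallIncrements b M) (t : unitInterval) :
    |f t| ≤ (10 * b + (b : ℝ) ^ M) * (9 / 10 : ℝ) ^ M := by
  have h1 := abs_sub_node_floor_le hb hf le_rfl t
  have hkM := floor_mul_pow_le b M t
  have h2 := abs_sub_node_le hf le_rfl (a := 0) (d := ⌊(t : ℝ) * (b : ℝ) ^ M⌋₊) (by omega)
  have h0 : node b M 0 = 0 := Subtype.ext (by rw [coe_node hb (by omega)]; simp)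
  rw [h0, hf.1, sub_zero, zero_add] at h2
  have hd : ((⌊(t : ℝ) * (b : ℝ) ^ M⌋₊ : ℕ) : ℝ) ≤ (b : ℝ) ^ M := by exact_mod_cast hkM
  have h9 : (0 : ℝ) < (9 / 10 : ℝ) ^ M := by positivity
  rw [abs_le] at h1 h2 ⊢
  constructor <;> nlinarith

end Chaining

lemma isCompact_smallIncrements {b : ℕ} (hb : 2 ≤ b) (M : ℕ) :
    IsCompact (smallIncrements b M) := by
  have hb1 : (1 : ℝ) < b := by exact_mod_cast hb
  let e := (ContinuousMap.isometryEquivBoundedOfCompact unitInterval ℝ).toHomeomorph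
  rw [← e.symm.isCompact_preimage]
  refine BoundedContinuousFunction.arzela_ascoli₂
    (Metric.closedBall 0 ((10 * b + (b : ℝ) ^ M) * (9 / 10 : ℝ) ^ M)) (isCompact_closedBall _ _) _
    ((isClosed_smallIncrements b M).preimage e.symm.continuous) ?_ ?_
  · intro f t hf
    rw [mem_closedBall_zero_iff]
    exact abs_le_of_smallIncrements hb (f := e.symm f) hf t
  · intro t
    rw [Metric.equicontinuousAt_iff]
    intro δ hδ
    have h1 : Tendsto (fun m : ℕ ↦ (20 * (b : ℝ) + 1) * (9 / 10 : ℝ) ^ m) atTop (𝓝 0) := by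
      have := (tendsto_pow_atTop_nhds_zero_of_lt_one (r := (9 / 10 : ℝ)) (by norm_num)
        (by norm_num)).const_mul (20 * (b : ℝ) + 1)
      rwa [mul_zero] at this
    obtain ⟨m, hm, hmM⟩ := ((h1.eventually (gt_mem_nhds hδ)).and (eventually_ge_atTop M)).exists
    refine ⟨((b : ℝ) ^ m)⁻¹, by positivity, fun s hs f ↦ ?_⟩
    rw [Real.dist_eq, abs_sub_comm]
    exact (abs_sub_le_of_smallIncrements hb (f := e.symm f.1) f.2 hmM hs).trans_lt hm

/-- The law of the normalised cascade. -/
noncomputable def pathLaw (b : ℕ) (H : ℝ) (n : ℕ) : Measure C(unitInterval, ℝ) :=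
  (signMeasure b H).map (path b H n)

lemma isProbabilityMeasure_pathLaw {b : ℕ} (hb : 2 ≤ b) {H : ℝ} (hH : H < 1 / 2) (n : ℕ) :
    IsProbabilityMeasure (pathLaw b H n) := by
  have := isProbabilityMeasure_signMeasure hb hH
  exact Measure.isProbabilityMeasure_map (continuous_path b H n).aemeasurable

/-- Markov's inequality for the fourth moments and a union bound over all `b`-adic intervals of
level at least `M`. -/
lemma exists_pathLaw_compl_smallIncrements_le {b : ℕ} (hb : 2 ≤ b) {H : ℝ} (hH : H < 1 / 2) :
    ∃ C, ∀ M n, pathLaw b H n (smallIncrements b M)ᶜ ≤ ENNReal.ofReal (C * (4 / 5 : ℝ) ^ M) := by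
  have := isProbabilityMeasure_signMeasure hb hH
  have hb0 : (0 : ℝ) < b := by positivity
  have hb2 : (2 : ℝ) ≤ b := by exact_mod_cast hb
  obtain ⟨C, hC0, hC⟩ := exists_integral_increment_pow_four_le hb hH
  refine ⟨C * 5, fun M n ↦ ?_⟩
  have hc := fun s ↦ continuous_path_apply b H n s
  rw [pathLaw, Measure.map_apply (continuous_path b H n).measurable
    (isClosed_smallIncrements b M).measurableSet.compl]
  let A : ℕ → ℕ → Set (List (Fin b) → ℝ) := fun m i ↦
    {ε | ((9 / 10 : ℝ) ^ m) ^ 4 ≤ (path b H n ε (node b m (i + 1)) - path b H n ε (node b m i)) ^ 4}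
  have hsub : path b H n ⁻¹' (smallIncrements b M)ᶜ ⊆
      ⋃ m, ⋃ i ∈ Finset.range (b ^ (m + M)), A (m + M) i := by
    intro ε hε
    simp only [Set.mem_preimage, Set.mem_compl_iff, smallIncrements, Set.mem_ofPred_eq, not_and,
      not_forall, not_le] at hε
    obtain ⟨m, hm, i, hi, h⟩ := hε (path_apply_zero hb H n ε)
    obtain ⟨m, rfl⟩ := Nat.exists_eq_add_of_le' hm
    simp only [Set.mem_iUnion]
    refine ⟨m, i, Finset.mem_range.2 hi, ?_⟩
    change ((9 / 10 : ℝ) ^ (m + M)) ^ 4 ≤ _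
    rw [← Even.pow_abs (by decide : Even 4) (path b H n ε _ - _)]
    gcongr
  have hA : ∀ m, ∀ i ∈ Finset.range (b ^ m), signMeasure b H (A m i) ≤
      ENNReal.ofReal (C * ((b : ℝ) ^ m)⁻¹ ^ 2 / ((9 / 10 : ℝ) ^ m) ^ 4) := by
    intro m i hi
    rw [Finset.mem_range] at hi
    have h1 := mul_meas_ge_le_integral_of_nonneg (μ := signMeasure b H)
      (f := fun ε ↦ (path b H n ε (node b m (i + 1)) - path b H n ε (node b m i)) ^ 4)
      (ae_of_all _ fun ε ↦ by positivity)
      (integrable_of_continuous hb hH (by fun_prop)) (((9 / 10 : ℝ) ^ m) ^ 4)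
    have h2 := hC m n i _ _ (node_mul hb hi.le) (node_mul hb (by omega : i + 1 ≤ b ^ m))
    rw [← ENNReal.ofReal_toReal (measure_ne_top (signMeasure b H) (A m i))]
    refine ENNReal.ofReal_le_ofReal ?_
    rw [le_div_iff₀' (by positivity)]
    exact h1.trans h2
  have hsum : ∀ m, ∑ i ∈ Finset.range (b ^ m), signMeasure b H (A m i) ≤
      ENNReal.ofReal (C * (4 / 5 : ℝ) ^ m) := by
    intro m
    refine (Finset.sum_le_sum (hA m)).trans ?_
    rw [Finset.sum_const, Finset.card_range, nsmul_eq_mul, ← ENNReal.ofReal_natCast,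
      ← ENNReal.ofReal_mul (by positivity)]
    refine ENNReal.ofReal_le_ofReal ?_
    have e : ((b ^ m : ℕ) : ℝ) * (C * ((b : ℝ) ^ m)⁻¹ ^ 2 / ((9 / 10 : ℝ) ^ m) ^ 4) =
        C * ((b : ℝ)⁻¹ / (9 / 10) ^ 4) ^ m := by
      rw [div_pow (b : ℝ)⁻¹, inv_pow, pow_right_comm (9 / 10 : ℝ) 4 m]
      push_cast
      have hp : (b : ℝ) ^ m * ((b : ℝ) ^ m)⁻¹ = 1 := mul_inv_cancel₀ (by positivity)
      linear_combination (C * ((b : ℝ) ^ m)⁻¹ / ((9 / 10 : ℝ) ^ m) ^ 4) * hp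
    rw [e]
    have h1 : (b : ℝ)⁻¹ ≤ 1 / 2 := by
      rw [one_div]; gcongr
    refine mul_le_mul_of_nonneg_left (pow_le_pow_left₀ (by positivity) ?_ m) hC0
    rw [div_le_iff₀ (by norm_num)]
    norm_num at h1 ⊢
    linarith
  calc _ ≤ signMeasure b H (⋃ m, ⋃ i ∈ Finset.range (b ^ (m + M)), A (m + M) i) :=
        measure_mono hsub
    _ ≤ ∑' m, signMeasure b H (⋃ i ∈ Finset.range (b ^ (m + M)), A (m + M) i) :=
        measure_iUnion_le _
    _ ≤ ∑' m : ℕ, ENNReal.ofReal (C * (4 / 5 : ℝ) ^ (m + M)) :=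
        ENNReal.tsum_le_tsum fun m ↦ (measure_biUnion_finset_le _ _).trans (hsum _)
    _ = ENNReal.ofReal (C * 5 * (4 / 5 : ℝ) ^ M) := by
        have hg := (hasSum_geometric_of_lt_one (r := (4 / 5 : ℝ)) (by norm_num)
          (by norm_num)).mul_left (C * (4 / 5 : ℝ) ^ M)
        have hg' : HasSum (fun m : ℕ ↦ C * (4 / 5 : ℝ) ^ (m + M)) (C * 5 * (4 / 5 : ℝ) ^ M) := by
          have e1 : (fun m : ℕ ↦ C * (4 / 5 : ℝ) ^ (m + M)) =
              fun m ↦ C * (4 / 5 : ℝ) ^ M * (4 / 5 : ℝ) ^ m := by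
            ext m; ring
          have e2 : C * 5 * (4 / 5 : ℝ) ^ M = C * (4 / 5 : ℝ) ^ M * (1 - 4 / 5)⁻¹ := by
            norm_num; ring
          rw [e1, e2]
          exact hg
        rw [← ENNReal.ofReal_tsum_of_nonneg (fun m ↦ by positivity) hg'.summable, hg'.tsum_eq]

lemma isTightMeasureSet_pathLaw {b : ℕ} (hb : 2 ≤ b) {H : ℝ} (hH : H < 1 / 2) :
    IsTightMeasureSet (Set.range (pathLaw b H)) := by
  rw [isTightMeasureSet_iff_exists_isCompact_measure_compl_le]
  intro δ hδ
  obtain ⟨C, hC⟩ := exists_pathLaw_compl_smallIncrements_le hb hH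
  have h1 : Tendsto (fun M : ℕ ↦ ENNReal.ofReal (C * (4 / 5 : ℝ) ^ M)) atTop (𝓝 0) := by
    have := (tendsto_pow_atTop_nhds_zero_of_lt_one (r := (4 / 5 : ℝ)) (by norm_num)
      (by norm_num)).const_mul C
    rw [mul_zero] at this
    simpa using ENNReal.tendsto_ofReal this
  obtain ⟨M, hM⟩ := (h1.eventually (gt_mem_nhds hδ)).exists
  refine ⟨smallIncrements b M, isCompact_smallIncrements hb M, ?_⟩
  rintro _ ⟨n, rfl⟩
  exact (hC M n).trans hM.le

/-! ### Characterisation of Wiener measure -/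

/-- The finite-dimensional characteristic functions of the measure `μ` are those of Brownian
motion. -/
def HasBrownianChar (μ : Measure C(unitInterval, ℝ)) : Prop :=
  ∀ (ι : Type) [Fintype ι] (x : ι → ℝ) (t : ι → unitInterval),
    ∫ f, Complex.exp (((∑ k, x k * f (t k) : ℝ) : ℂ) * Complex.I) ∂μ = brownianChar x t

@[fun_prop]
lemma continuous_eval_path (t : unitInterval) : Continuous fun f : C(unitInterval, ℝ) ↦ f t :=
  continuous_eval_const t

/-- The finite-dimensional characteristic functions separate the finite measures on
`C([0, 1])`. -/
lemma HasBrownianChar.unique {μ ν : Measure C(unitInterval, ℝ)} [IsFiniteMeasure μ]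
    [IsFiniteMeasure ν] (hμ : HasBrownianChar μ) (hν : HasBrownianChar ν) : μ = ν := by
  classical
  -- finite linear combinations of evaluations, as a discrete space of test functionals
  let : TopologicalSpace (unitInterval →₀ ℝ) := ⊥
  have : DiscreteTopology (unitInterval →₀ ℝ) := ⟨rfl⟩
  let L : C(unitInterval, ℝ) →ₗ[ℝ] (unitInterval →₀ ℝ) →ₗ[ℝ] ℝ :=
    (Finsupp.bilinearCombination ℝ ℝ).comp (ContinuousMap.coeFnLinearMap ℝ)
  have hLapp : ∀ (f : C(unitInterval, ℝ)) (w : unitInterval →₀ ℝ),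
      L f w = ∑ k : w.support, w k * f k := by
    intro f w
    change Finsupp.linearCombination ℝ f w = _
    rw [Finsupp.linearCombination_apply, Finsupp.sum, ← Finset.sum_coe_sort]
    rfl
  have hL : Continuous fun p : C(unitInterval, ℝ) × (unitInterval →₀ ℝ) ↦ L p.1 p.2 := by
    rw [continuous_prod_of_discrete_right]
    intro w
    simp only [hLapp]
    fun_prop
  refine ext_of_integral_char_eq Real.continuous_probChar Real.probChar_ne_one (L := L) ?_ hL ?_
  · intro f hf hLf
    apply hf
    ext t
    have h := LinearMap.congr_fun hLf (Finsupp.single t 1)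
    change Finsupp.linearCombination ℝ f (Finsupp.single t 1) = 0 at h
    simpa using h
  · intro w
    simp only [BoundedContinuousFunction.char_apply, Real.probChar_apply, hLapp]
    rw [hμ w.support (fun k ↦ w k) (fun k ↦ k), hν w.support (fun k ↦ w k) (fun k ↦ k)]

lemma HasBrownianChar.integral_exp_increments {μ : Measure C(unitInterval, ℝ)}
    (hμ : HasBrownianChar μ) {n : ℕ} {τ : Fin (n + 1) → unitInterval} (hτ : Monotone τ)
    (y : Fin n → ℝ) :
    ∫ f, Complex.exp (((∑ i, y i * (f (τ i.succ) - f (τ i.castSucc)) : ℝ) : ℂ) * Complex.I) ∂μ =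
      ∏ i, Complex.exp
        ((-((τ i.succ : ℝ) - (τ i.castSucc : ℝ)) * y i ^ 2 / 2 : ℝ) : ℂ) := by
  have h := hμ (Fin n ⊕ Fin n) (Sum.elim y fun i ↦ -y i)
    (Sum.elim (fun i ↦ τ i.succ) fun i ↦ τ i.castSucc)
  simp only [Fintype.sum_sum_type, Sum.elim_inl, Sum.elim_inr, brownianChar] at h
  have e1 : ∀ f : C(unitInterval, ℝ), ∑ i, y i * (f (τ i.succ) - f (τ i.castSucc)) =
      ∑ i, y i * f (τ i.succ) + ∑ i, -y i * f (τ i.castSucc) := by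
    intro f
    rw [← Finset.sum_add_distrib]
    exact Finset.sum_congr rfl fun i _ ↦ by ring
  simp only [e1]
  rw [h, ← Complex.exp_sum, ← Complex.ofReal_sum]
  congr 2
  rw [← Finset.sum_div]
  congr 1
  rw [← Finset.sum_add_distrib, ← Finset.sum_neg_distrib]
  refine Finset.sum_congr rfl fun i _ ↦ ?_
  rw [← Finset.sum_add_distrib, ← Finset.sum_add_distrib, ← Finset.sum_add_distrib,
    Finset.sum_eq_single i]
  · have h1 : τ i.castSucc ≤ τ i.succ := hτ (Fin.castSucc_le_succ i)
    rw [min_eq_left h1, min_eq_right h1, min_self, min_self]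
    ring
  · intro j _ hij
    rcases lt_or_gt_of_ne hij with hlt | hlt
    · have h1 : τ j.succ ≤ τ i.castSucc := hτ (by
        rw [Fin.le_def]; simpa using Nat.succ_le_of_lt hlt)
      have h2 : τ i.castSucc ≤ τ i.succ := hτ (Fin.castSucc_le_succ i)
      have h3 : τ j.castSucc ≤ τ j.succ := hτ (Fin.castSucc_le_succ j)
      rw [min_eq_right (h1.trans h2), min_eq_right (h3.trans (h1.trans h2)), min_eq_right h1,
        min_eq_right (h3.trans h1)]
      ring
    · have h1 : τ i.succ ≤ τ j.castSucc := hτ (by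
        rw [Fin.le_def]; simpa using Nat.succ_le_of_lt hlt)
      have h2 : τ j.castSucc ≤ τ j.succ := hτ (Fin.castSucc_le_succ j)
      have h3 : τ i.castSucc ≤ τ i.succ := hτ (Fin.castSucc_le_succ i)
      rw [min_eq_left (h1.trans h2), min_eq_left (h3.trans (h1.trans h2)), min_eq_left h1,
        min_eq_left (h3.trans h1)]
      ring
  · simp

lemma HasBrownianChar.hasLaw_increment {μ : Measure C(unitInterval, ℝ)} [IsProbabilityMeasure μ]
    (hμ : HasBrownianChar μ) {s t : unitInterval} (hst : s ≤ t) :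
    HasLaw (fun f : C(unitInterval, ℝ) ↦ f t - f s)
      (gaussianReal 0 (Real.toNNReal ((t : ℝ) - (s : ℝ)))) μ := by
  have hc : Continuous fun f : C(unitInterval, ℝ) ↦ f t - f s := by fun_prop
  have := Measure.isProbabilityMeasure_map (μ := μ) hc.aemeasurable
  refine ⟨hc.aemeasurable, Measure.ext_of_charFun ?_⟩
  ext y
  have hτ : Monotone ![s, t] := by
    intro i j hij
    fin_cases i <;> fin_cases j <;> simp_all
  have h := hμ.integral_exp_increments hτ (fun _ ↦ y)
  simp only [Finset.univ_unique, Finset.sum_singleton, Finset.prod_singleton, Fin.default_eq_zero,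
    Fin.succ_zero_eq_one, Fin.castSucc_zero, Matrix.cons_val_zero, Matrix.cons_val_one] at h
  rw [charFun_gaussianReal, charFun_apply_real, integral_map hc.aemeasurable (by fun_prop)]
  simp only [← Complex.ofReal_mul]
  rw [h, Real.coe_toNNReal _ (sub_nonneg.2 hst)]
  push_cast
  ring_nf

/-- A measure with the finite-dimensional characteristic functions of Brownian motion is Wiener
measure. -/
lemma HasBrownianChar.isWienerMeasure {μ : Measure C(unitInterval, ℝ)} [IsProbabilityMeasure μ]
    (hμ : HasBrownianChar μ) : IsWienerMeasure μ where
  isProbabilityMeasure := inferInstance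
  start_zero := by
    have hc : Continuous fun f : C(unitInterval, ℝ) ↦ f 0 := by fun_prop
    have := Measure.isProbabilityMeasure_map (μ := μ) hc.aemeasurable
    have h0 : μ.map (fun f : C(unitInterval, ℝ) ↦ f 0) = Measure.dirac 0 := by
      apply Measure.ext_of_charFun
      ext y
      have h := hμ Unit (fun _ ↦ y) (fun _ ↦ 0)
      simp only [Finset.univ_unique, Finset.sum_singleton, brownianChar] at h
      rw [charFun_apply_real, charFun_apply_real, integral_map hc.aemeasurable (by fun_prop)]
      simp only [← Complex.ofReal_mul]
      rw [h]
      simp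
    have h1 : ∀ᵐ z ∂μ.map (fun f : C(unitInterval, ℝ) ↦ f 0), z = 0 := by
      rw [h0, ae_dirac_eq]
      exact eventually_pure.2 rfl
    exact ae_of_ae_map hc.aemeasurable h1
  hasIndepIncrements := by
    intro n τ hτ
    have hc : ∀ i : Fin n, Continuous fun f : C(unitInterval, ℝ) ↦
        f (τ i.succ) - f (τ i.castSucc) := fun i ↦ by fun_prop
    rw [iIndepFun_iff_charFun_pi fun i ↦ (hc i).aemeasurable]
    intro y
    have hm : Measurable fun f : C(unitInterval, ℝ) ↦
        WithLp.toLp 2 fun i ↦ f (τ (Fin.succ i)) - f (τ (Fin.castSucc i)) :=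
      (PiLp.continuous_toLp 2 _ |>.comp (continuous_pi hc)).measurable
    rw [charFun_apply, integral_map hm.aemeasurable (by fun_prop)]
    simp only [PiLp.inner_apply, RCLike.inner_apply, conj_trivial]
    rw [hμ.integral_exp_increments hτ y.ofLp]
    refine Finset.prod_congr rfl fun i _ ↦ ?_
    have hle : τ i.castSucc ≤ τ i.succ := hτ (Fin.castSucc_le_succ i)
    rw [(hμ.hasLaw_increment hle).map_eq, charFun_gaussianReal,
      Real.coe_toNNReal _ (sub_nonneg.2 hle)]
    push_cast
    ring_nf
  hasLaw_increment _ _ hst := hμ.hasLaw_increment hst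

/-! ### Cluster points of the laws of the cascades -/

/-- By continuity of the paths, it is enough to know the finite-dimensional characteristic
functions at `b`-adic times. -/
lemma hasBrownianChar_of_badic {b : ℕ} (hb : 2 ≤ b) {μ : Measure C(unitInterval, ℝ)}
    [IsProbabilityMeasure μ]
    (h : ∀ (m : ℕ) (ι : Type) [Fintype ι] (x : ι → ℝ) (t : ι → unitInterval),
      (∀ k, ∃ i : ℕ, (t k : ℝ) * (b : ℝ) ^ m = i) →
      ∫ f, Complex.exp (((∑ k, x k * f (t k) : ℝ) : ℂ) * Complex.I) ∂μ = brownianChar x t) :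
    HasBrownianChar μ := by
  intro ι _ x t
  let u : ℕ → ι → unitInterval := fun m k ↦ node b m ⌊(t k : ℝ) * (b : ℝ) ^ m⌋₊
  have hu : Tendsto u atTop (𝓝 t) := tendsto_pi_nhds.2 fun k ↦ tendsto_node_floor hb (t k)
  have h1 : Continuous fun t : ι → unitInterval ↦
      ∫ f : C(unitInterval, ℝ), Complex.exp (((∑ k, x k * f (t k) : ℝ) : ℂ) * Complex.I) ∂μ := by
    refine continuous_of_dominated (bound := fun _ ↦ 1) (fun t ↦ ?_) (fun t ↦ ae_of_all _ fun f ↦ ?_)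
      (integrable_const _) (ae_of_all _ fun f ↦ ?_)
    · exact Continuous.aestronglyMeasurable (by fun_prop)
    · rw [Complex.norm_exp_ofReal_mul_I]
    · fun_prop
  have h2 : Continuous fun t : ι → unitInterval ↦ brownianChar x t := by
    unfold brownianChar
    fun_prop
  refine tendsto_nhds_unique ((h1.tendsto t).comp hu) (((h2.tendsto t).comp hu).congr fun m ↦ ?_)
  exact (h m ι x (u m) fun k ↦ ⟨_, node_mul hb (floor_mul_pow_le b m (t k))⟩).symm

/-- The law of the normalised cascade, as an element of the space of probability measures. -/
noncomputable def pathProbLaw {b : ℕ} (hb : 2 ≤ b) {H : ℝ} (hH : H < 1 / 2) (n : ℕ) :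
    ProbabilityMeasure C(unitInterval, ℝ) :=
  ⟨pathLaw b H n, isProbabilityMeasure_pathLaw hb hH n⟩

lemma isCompact_closure_range_pathProbLaw {b : ℕ} (hb : 2 ≤ b) {H : ℝ} (hH : H < 1 / 2) :
    IsCompact (closure (Set.range (pathProbLaw hb hH))) := by
  apply isCompact_closure_of_isTightMeasureSet
  convert isTightMeasureSet_pathLaw hb hH using 1
  ext ν
  constructor
  · rintro ⟨_, ⟨n, rfl⟩, rfl⟩
    exact ⟨n, rfl⟩
  · rintro ⟨n, rfl⟩
    exact ⟨_, ⟨n, rfl⟩, rfl⟩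

lemma hasBrownianChar_of_mapClusterPt {b : ℕ} (hb : 2 ≤ b) {H : ℝ} (hH : H < 1 / 2)
    {ν : ProbabilityMeasure C(unitInterval, ℝ)} (hν : MapClusterPt ν atTop (pathProbLaw hb hH)) :
    HasBrownianChar (ν : Measure C(unitInterval, ℝ)) := by
  refine hasBrownianChar_of_badic hb fun m ι _ x t ht ↦ ?_
  obtain ⟨U, hU, hlim⟩ := mapClusterPt_iff_ultrafilter.1 hν
  have hc : Continuous fun f : C(unitInterval, ℝ) ↦
      Complex.exp (((∑ k, x k * f (t k) : ℝ) : ℂ) * Complex.I) := by fun_prop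
  let g := BoundedContinuousFunction.ofNormedAddCommGroup _ hc 1
    fun f ↦ (Complex.norm_exp_ofReal_mul_I _).le
  have h1 := (ProbabilityMeasure.tendsto_iff_forall_integral_rclike_tendsto ℂ).1 hlim g
  refine tendsto_nhds_unique h1 (((tendsto_pathChar hb hH m x t ht).mono_left hU).congr fun n ↦ ?_)
  change _ = ∫ f, g f ∂pathLaw b H n
  rw [pathLaw, integral_map (continuous_path b H n).aemeasurable g.continuous.aestronglyMeasurable]
  rfl

lemma exists_hasBrownianChar :
    ∃ W : ProbabilityMeasure C(unitInterval, ℝ),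
      HasBrownianChar (W : Measure C(unitInterval, ℝ)) := by
  -- any admissible pair `(b, H)` serves to construct Wiener measure
  have hH : (0 : ℝ) < 1 / 2 := by norm_num
  obtain ⟨ν, -, hν⟩ := (isCompact_closure_range_pathProbLaw le_rfl hH).exists_mapClusterPt
    (u := pathProbLaw le_rfl hH) (f := atTop)
    (tendsto_principal.2 (Eventually.of_forall fun n ↦ subset_closure (Set.mem_range_self n)))
  exact ⟨ν, hasBrownianChar_of_mapClusterPt le_rfl hH hν⟩

lemma tendsto_pathProbLaw {b : ℕ} (hb : 2 ≤ b) {H : ℝ} (hH : H < 1 / 2)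
    {W : ProbabilityMeasure C(unitInterval, ℝ)}
    (hW : HasBrownianChar (W : Measure C(unitInterval, ℝ))) :
    Tendsto (pathProbLaw hb hH) atTop (𝓝 W) := by
  refine (isCompact_closure_range_pathProbLaw hb hH).tendsto_nhds_of_unique_mapClusterPt
    (Eventually.of_forall fun n ↦ subset_closure (Set.mem_range_self n)) fun ν _ hν ↦ ?_
  have h : (ν : Measure C(unitInterval, ℝ)) = (W : Measure C(unitInterval, ℝ)) :=
    (hasBrownianChar_of_mapClusterPt hb hH hν).unique hW
  exact Subtype.ext h

end BilateralCascade

theorem theorem1 :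
    ∃ W : ProbabilityMeasure C(unitInterval, ℝ),
      IsWienerMeasure (W : Measure C(unitInterval, ℝ)) ∧
      ∀ (b : ℕ), 2 ≤ b → ∀ (H : ℝ), H < 1 / 2 →
        ∀ {Ω : Type*} [MeasurableSpace Ω] (P : Measure Ω) [IsProbabilityMeasure P]
          (ε : List (Fin b) → Ω → ℝ),
          (∀ w, HasLaw (ε w) (BilateralCascade.signLaw b H) P) →
          iIndepFun ε P →
          TendstoInDistribution
            (fun (n : ℕ) (ω : Ω) ↦
              (BilateralCascade.sigma b H * (b : ℝ) ^ ((n : ℝ) * (1 / 2 - H)))⁻¹ •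
                BilateralCascade.cascade b H (fun w ↦ ε w ω) n)
            atTop
            (id : C(unitInterval, ℝ) → C(unitInterval, ℝ))
            (fun _ ↦ P)
            (W : Measure C(unitInterval, ℝ)) := by
  obtain ⟨W, hW⟩ := BilateralCascade.exists_hasBrownianChar
  refine ⟨W, hW.isWienerMeasure, fun b hb H hH Ω _ P _ ε hlaw hindep ↦ ?_⟩
  have hm : AEMeasurable (fun ω w ↦ ε w ω) P :=
    aemeasurable_pi_lambda _ fun w ↦ (hlaw w).aemeasurable
  have hε : P.map (fun ω w ↦ ε w ω) = BilateralCascade.signMeasure b H :=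
    (hindep.hasLaw_infinitePi hlaw hm).map_eq
  have hc := fun n ↦ (BilateralCascade.continuous_path b H n).measurable
  refine ⟨fun n ↦ (hc n).comp_aemeasurable hm, aemeasurable_id, ?_⟩
  refine ((BilateralCascade.tendsto_pathProbLaw hb hH hW).congr fun n ↦ Subtype.ext ?_).mono_right
    (le_of_eq (congrArg 𝓝 (Subtype.ext Measure.map_id.symm)))
  change BilateralCascade.pathLaw b H n = P.map (BilateralCascade.path b H n ∘ fun ω w ↦ ε w ω)
  rw [BilateralCascade.pathLaw, ← hε, AEMeasurable.map_map_of_aemeasurable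
    (hc n).aemeasurable hm]
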